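/- Let $A\in\mathbb R^{n\times n}$ and $B_{i\sigma}\in\mathbb R^{n\times 1}$ ($1\le i\le q$, $1\le\sigma\le p$, $q\ge 2$) satisfy $\sum_{i=1}^q B_{i\sigma}=0$ for every $\sigma$, and consider the array $\dot x_i=Ax_i+\sum_{\sigma=1}^p B_{i\sigma}u_\sigma$, $i=1,\dots,q$. Fix distinct $k,\ell\in\{1,\dots,q\}$. The array is positively $(k,\ell)$-controllable if for all initial conditions $(x_1(0),\dots,x_q(0))$ there are $\tau>0$ and inputs $u_\sigma:[0,\tau]\to\mathbb R_{\ge 0}$ such that $x_k(\tau)=x_\ell(\tau)$ and $x_i(\tau)=e^{A\tau}x_i(0)$ for all $i\ne k,\ell$. Let $\mathbf A=I_q\otimes A$, let $\mathbf B\in\mathbb R^{(qn)\times p}$ be the matrix with blocks $B_{i\sigma}$, and let $$\mathcal R=\Big\{\int_0^\tau e^{\mathbf A(\tau-t)}\mathbf B\,u(t)\,dt:\ \tau\ge 0,\ u:[0,\tau]\to\mathbb R_{\ge 0}^p\Big\}.$$ (Inputs are integrable.) Here $e_i$ is the $i$th unit vector of $\mathbb R^q$. A matrix $G$ with $qd$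 rows is called $(k,\ell)$-connected if $\operatorname{range}G\supset\operatorname{range}[(e_k-e_\ell)\otimes I_d]$, and strongly $(k,\ell)$-connected if it is real and $\operatorname{cone}G:=\{G\alpha:\alpha\ge 0\}\supset\operatorname{range}[(e_k-e_\ell)\otimes I_d]$. Let $\mu_1,\dots,\mu_m$ be the distinct (complex) eigenvalues of $A^*$, with algebraic multiplicities $n_1,\dots,n_m$, enumerated so that $\operatorname{Re}\mu_1\ge\dots\ge\operatorname{Re}\mu_m$ and so that $\operatorname{Re}\mu_\kappa=\mu_\nu$ with $\kappa\neq\nu$ implies $\kappa>\nu$. Let $U_\kappa\in\mathbb C^{n\times n_\kappa}$ have full column rank with $\operatorname{range}U_\kappa=\operatorname{null}[A^*-\mu_\kappa I_n]^{n_\kappa}$, $U_\kappa$ real if $\mu_\kappa$ is real; let $A_\kappa$ be the matrix with $A^*U_\kappa=U_\kappa A_\kappa^*$, and put $\Lambda_\kappa=[A_\kappa^*-\mu_\kappa I_{n_\kappa}]^*$, $B^{[\kappa]}_{i\sigma}=U_\kappa^*B_{i\sigma}$ and $Q^{[\kappa]}_{i\sigma}=[B^{[\kappa]}_{i\sigma}\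 \ \Lambda_\kappa B^{[\kappa]}_{i\sigma}\ \cdots\ \Lambda_\kappa^{n_\kappa-1}B^{[\kappa]}_{i\sigma}]$. Let $B^{[\kappa]}_{:\sigma}$ be the column obtained by stacking $B^{[\kappa]}_{1\sigma},\dots,B^{[\kappa]}_{q\sigma}$ and, for $\mathcal I\subset\{1,\dots,p\}$, let $\operatorname{inc}(Q^{[\kappa]}_{:\sigma})_{\sigma\in\mathcal I}$ be the block matrix with block rows $i=1,\dots,q$, block columns $\sigma\in\mathcal I$ and blocks $Q^{[\kappa]}_{i\sigma}$. Define index sets by $\mathcal I_1=\{1,\dots,p\}$ and $\mathcal I_{\kappa+1}=\mathcal I_\kappa\setminus\mathcal I_\kappa^-$, where $\mathcal I_\kappa^-=\emptyset$ if $\mu_\kappa\notin\mathbb R$, and, if $\mu_\kappa\in\mathbb R$, $$\mathcal I_\kappa^-=\{\sigma\in\mathcal I_\kappa:\ [I_q\otimes\Lambda_\kappa^r]B^{[\kappa]}_{:\sigma}\notin\mathcal Q_\kappa\text{ for some }r\in\{0,\dots,n_\kappa-1\}\},$$ with $\mathcal Q_\kappa$ the largest subspace contained in $\operatorname{cone}[\operatorname{inc}(Q^{[\kappa]}_{:\sigma})_{\sigma\in\mathcal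 I_\kappa}]$. Assume: (1) if $\mu_\kappa\notin\mathbb R$ and $\operatorname{Re}\mu_\kappa=\mu_\nu$ for some $\nu$, then $\Lambda_\kappa=0$; (2) if $\operatorname{cl}\mathcal R\supset\operatorname{range}[(e_k-e_\ell)\otimes I_n]$, then $\mathcal R\supset\operatorname{range}[(e_k-e_\ell)\otimes I_n]$. Then the array is positively $(k,\ell)$-controllable if and only if both of the following hold: (a) $\operatorname{inc}(Q^{[\kappa]}_{:\sigma})_{\sigma\in\mathcal I_\kappa}$ is strongly $(k,\ell)$-connected for all $\kappa$ with $\mu_\kappa\in\mathbb R$; (b) $\operatorname{inc}(Q^{[\kappa]}_{:\sigma})_{\sigma\in\mathcal I_\kappa}$ is $(k,\ell)$-connected for all $\kappa$ with $\mu_\kappa\notin\mathbb R$. -/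

import Mathlib

open Matrix MeasureTheory
open scoped Kronecker

noncomputable section

namespace RelArray

/-! ### Arrays of systems `ẋ_i = A x_i + ∑_σ B_{iσ} u_σ` and positive controllability -/

/-- The actuation is relative: `∑_i B_{iσ} = 0` for every `σ`. -/
def IsRelative {q p n : ℕ} (B : Fin q → Fin p → Fin n → ℝ) : Prop :=
  ∀ σ, ∑ i, B i σ = 0

/-- Nonnegative input signals on the time interval `[0, τ]` (integrable, so that the
differential equation makes sense). -/
def IsPositiveInput {p : ℕ} (τ : ℝ) (u : ℝ → Fin p → ℝ) : Prop :=
  (∀ σ, IntervalIntegrable (fun t => u t σ) volume 0 τ) ∧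
    ∀ t ∈ Set.Icc (0 : ℝ) τ, ∀ σ, 0 ≤ u t σ

/-- `x` is a (Carathéodory) solution on `[0, τ]` of the array
`ẋ_i = A x_i + ∑_σ B_{iσ} u_σ`, `i = 1, …, q`: it is continuous and satisfies the
equation in integrated form. -/
def IsTrajectory {q p n : ℕ} (A : Matrix (Fin n) (Fin n) ℝ) (B : Fin q → Fin p → Fin n → ℝ)
    (τ : ℝ) (u : ℝ → Fin p → ℝ) (x : ℝ → Fin q → Fin n → ℝ) : Prop :=
  ContinuousOn x (Set.Icc 0 τ) ∧
    ∀ t ∈ Set.Icc (0 : ℝ) τ, ∀ i,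
      x t i = x 0 i + ∫ s in (0 : ℝ)..t, (A *ᵥ x s i + ∑ σ, u s σ • B i σ)

/-- Positive `(k, ℓ)`-controllability of the array `[A, (B_{iσ})]`. -/
def PositivelyPairControllable {q p n : ℕ} (A : Matrix (Fin n) (Fin n) ℝ)
    (B : Fin q → Fin p → Fin n → ℝ) (k l : Fin q) : Prop :=
  ∀ x₀ : Fin q → Fin n → ℝ, ∃ τ : ℝ, 0 < τ ∧ ∃ u : ℝ → Fin p → ℝ, IsPositiveInput τ u ∧
    ∃ x : ℝ → Fin q → Fin n → ℝ, IsTrajectory A B τ u x ∧ x 0 = x₀ ∧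
      x τ k = x τ l ∧
      ∀ i, i ≠ k → i ≠ l → x τ i = NormedSpace.exp (τ • A) *ᵥ x₀ i

/-- The system matrix `I_q ⊗ A` of the array seen as one big system. -/
def bigA (q : ℕ) {n : ℕ} (A : Matrix (Fin n) (Fin n) ℝ) :
    Matrix (Fin q × Fin n) (Fin q × Fin n) ℝ :=
  (1 : Matrix (Fin q) (Fin q) ℝ) ⊗ₖ A

/-- The input matrix `inc (B_{iσ})` of the big system. -/
def bigB {q p n : ℕ} (B : Fin q → Fin p → Fin n → ℝ) : Matrix (Fin q × Fin n) (Fin p) ℝ :=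
  Matrix.of fun ia σ => B ia.1 σ ia.2

/-- The set of points positively reachable from the origin in finite time. -/
def reachable {q p n : ℕ} (A : Matrix (Fin n) (Fin n) ℝ) (B : Fin q → Fin p → Fin n → ℝ) :
    Set (Fin q × Fin n → ℝ) :=
  {ξ | ∃ τ : ℝ, 0 ≤ τ ∧ ∃ u : ℝ → Fin p → ℝ, IsPositiveInput τ u ∧
    ξ = ∫ t in (0 : ℝ)..τ, NormedSpace.exp ((τ - t) • bigA q A) *ᵥ (bigB B *ᵥ u t)}

/-! ### Connectivity of matrices -/

/-- The matrix `(e_k - e_ℓ) ⊗ I_d`. -/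
def pairMatrix (𝕜 : Type) [RCLike 𝕜] {q : ℕ} (k l : Fin q) (d : ℕ) :
    Matrix (Fin q × Fin d) (Fin d) 𝕜 :=
  Matrix.of fun ia b =>
    (Pi.single k (1 : 𝕜) - Pi.single l (1 : 𝕜) : Fin q → 𝕜) ia.1 *
      (1 : Matrix (Fin d) (Fin d) 𝕜) ia.2 b

/-- `cone G = {G α : α ≥ 0}` for a real matrix `G`. -/
def cone {ρ ι : Type} [Fintype ι] (G : Matrix ρ ι ℝ) : Set (ρ → ℝ) :=
  {ζ | ∃ α : ι → ℝ, (∀ j, 0 ≤ α j) ∧ ζ = G *ᵥ α}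

/-- `(k, ℓ)`-connectivity: `range G ⊇ range [(e_k - e_ℓ) ⊗ I_d]`. -/
def PairConnected {q d : ℕ} {ι : Type} [Fintype ι] (G : Matrix (Fin q × Fin d) ι ℂ)
    (k l : Fin q) : Prop :=
  Set.range (pairMatrix ℂ k l d).mulVec ⊆ Set.range G.mulVec

/-- Strong `(k, ℓ)`-connectivity: `G` is real and `cone G ⊇ range [(e_k - e_ℓ) ⊗ I_d]`. -/
def StronglyPairConnected {q d : ℕ} {ι : Type} [Fintype ι] (G : Matrix (Fin q × Fin d) ι ℂ)
    (k l : Fin q) : Prop :=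
  (∀ a j, (G a j).im = 0) ∧
    Set.range (pairMatrix ℝ k l d).mulVec ⊆ cone (G.map Complex.re)

/-- The incidence matrix of a collection of `d × ρ` blocks `C i σ`, with columns restricted to
the index set `I`. -/
def inc {q p d : ℕ} {ρ : Type} (C : Fin q → Fin p → Matrix (Fin d) ρ ℂ) (I : Finset (Fin p)) :
    Matrix (Fin q × Fin d) (I × ρ) ℂ :=
  Matrix.of fun ia σr => C ia.1 σr.1 ia.2 σr.2

/-! ### Spectral data of `A*` -/

/-- The matrix `A*`, regarded as a complex matrix. -/
def adj {n : ℕ} (A : Matrix (Fin n) (Fin n) ℝ) : Matrix (Fin n) (Fin n) ℂ :=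
  (A.map Complex.ofReal)ᴴ

/-- The algebraic multiplicity of `z` as an eigenvalue of `A*`. -/
def algMult {n : ℕ} (A : Matrix (Fin n) (Fin n) ℝ) (z : ℂ) : ℕ :=
  (adj A).charpoly.rootMultiplicity z

/-- A choice of the auxiliary objects attached to the spectrum of `A*`: an admissible enumeration
`μ_1, …, μ_m` of the distinct eigenvalues, bases `U_κ` of the generalized eigenspaces, and the
matrices `A_κ` of `A*` in those bases. -/
structure SpectralData {n : ℕ} (A : Matrix (Fin n) (Fin n) ℝ) where
  /-- the number of distinct eigenvalues -/
  m : ℕ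
  /-- the distinct eigenvalues of `A*` -/
  μ : Fin m → ℂ
  μ_injective : Function.Injective μ
  μ_range : ∀ z : ℂ, (∃ κ, μ κ = z) ↔ Module.End.HasEigenvalue (Matrix.toLin' (adj A)) z
  /-- real parts are nonincreasing -/
  μ_antitone : ∀ κ ν, κ ≤ ν → (μ ν).re ≤ (μ κ).re
  /-- a real eigenvalue precedes the other eigenvalues with the same real part -/
  μ_real_first : ∀ κ ν, κ ≠ ν → ((μ κ).re : ℂ) = μ ν → ν < κ
  /-- the columns of `U κ` form a basis of `null (A* - μ_κ I)^{n_κ}` -/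
  U : ∀ κ, Matrix (Fin n) (Fin (algMult A (μ κ))) ℂ
  U_linearIndependent : ∀ κ, LinearIndependent ℂ (U κ).col
  U_range : ∀ κ, LinearMap.range (U κ).mulVecLin =
    LinearMap.ker ((adj A - μ κ • (1 : Matrix (Fin n) (Fin n) ℂ)) ^ algMult A (μ κ)).mulVecLin
  /-- `U κ` is real for a real eigenvalue -/
  U_real : ∀ κ, (μ κ).im = 0 → ∀ a b, (U κ a b).im = 0
  /-- the matrix `A_κ`, determined by `A* U_κ = U_κ A_κ*` -/
  Ared : ∀ κ, Matrix (Fin (algMult A (μ κ))) (Fin (algMult A (μ κ))) ℂ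
  Ared_spec : ∀ κ, adj A * U κ = U κ * (Ared κ)ᴴ

namespace SpectralData

variable {q p n : ℕ} {A : Matrix (Fin n) (Fin n) ℝ}

/-- The algebraic multiplicity `n_κ`. -/
abbrev mult (D : SpectralData A) (κ : Fin D.m) : ℕ := algMult A (D.μ κ)

/-- `Λ_κ = [A_κ* - μ_κ I]*`. -/
def Lam (D : SpectralData A) (κ : Fin D.m) : Matrix (Fin (D.mult κ)) (Fin (D.mult κ)) ℂ :=
  ((D.Ared κ)ᴴ - D.μ κ • (1 : Matrix (Fin (D.mult κ)) (Fin (D.mult κ)) ℂ))ᴴ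

/-- `B_{iσ}^{[κ]} = U_κ* B_{iσ}`. -/
def Bk (D : SpectralData A) (B : Fin q → Fin p → Fin n → ℝ) (κ : Fin D.m) (i : Fin q)
    (σ : Fin p) : Fin (D.mult κ) → ℂ :=
  (D.U κ)ᴴ *ᵥ fun a => (B i σ a : ℂ)

/-- `Q_{iσ}^{[κ]} = [B_{iσ}^{[κ]}, Λ_κ B_{iσ}^{[κ]}, …, Λ_κ^{n_κ - 1} B_{iσ}^{[κ]}]`. -/
def Q (D : SpectralData A) (B : Fin q → Fin p → Fin n → ℝ) (κ : Fin D.m) (i : Fin q)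
    (σ : Fin p) : Matrix (Fin (D.mult κ)) (Fin (D.mult κ)) ℂ :=
  Matrix.of fun a r => (D.Lam κ ^ (r : ℕ) *ᵥ D.Bk B κ i σ) a

/-- The largest subspace contained in `cone [inc (Q_{:σ}^{[κ]})_{σ ∈ I}]` (the matrix is real when
`μ_κ` is real, the only case in which this is used). The cone is closed under addition, so the
supremum of the subspaces that it contains is again contained in it. -/
def lineality (D : SpectralData A) (B : Fin q → Fin p → Fin n → ℝ) (κ : Fin D.m)
    (I : Finset (Fin p)) : Submodule ℝ (Fin q × Fin (D.mult κ) → ℝ) :=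
  sSup {S | (S : Set (Fin q × Fin (D.mult κ) → ℝ)) ⊆ cone ((inc (D.Q B κ) I).map Complex.re)}

/-- The vector `[I_q ⊗ Λ_κ^r] B_{:σ}^{[κ]}`, as a real vector (it is real when `μ_κ` is). -/
def LamB (D : SpectralData A) (B : Fin q → Fin p → Fin n → ℝ) (κ : Fin D.m) (r : ℕ)
    (σ : Fin p) : Fin q × Fin (D.mult κ) → ℝ :=
  fun ia => ((D.Lam κ ^ r *ᵥ D.Bk B κ ia.1 σ) ia.2).re

open Classical in
/-- The set `I_κ^-` of indices that are removed from `I_κ = I`. -/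
def removed (D : SpectralData A) (B : Fin q → Fin p → Fin n → ℝ) (κ : Fin D.m)
    (I : Finset (Fin p)) : Finset (Fin p) :=
  if (D.μ κ).im = 0 then
    I.filter fun σ => ∃ r : Fin (D.mult κ), D.LamB B κ r σ ∉ D.lineality B κ I
  else ∅

/-- The recursion `I_{κ+1} = I_κ \ I_κ^-` starting from the full index set. The count starts
at `0` here, and the sequence is constant once the eigenvalues are exhausted. -/
def indexSeq (D : SpectralData A) (B : Fin q → Fin p → Fin n → ℝ) : ℕ → Finset (Fin p)
  | 0 => Finset.univ
  | j + 1 =>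
    if h : j < D.m then indexSeq D B j \ D.removed B ⟨j, h⟩ (indexSeq D B j)
    else indexSeq D B j

/-- The index set `I_κ`. -/
def index (D : SpectralData A) (B : Fin q → Fin p → Fin n → ℝ) (κ : Fin D.m) :
    Finset (Fin p) :=
  D.indexSeq B κ

/-- The matrix `inc (Q_{:σ}^{[κ]})_{σ ∈ I_κ}`. -/
def incQ (D : SpectralData A) (B : Fin q → Fin p → Fin n → ℝ) (κ : Fin D.m) :
    Matrix (Fin q × Fin (D.mult κ)) (D.index B κ × Fin (D.mult κ)) ℂ :=
  inc (D.Q B κ) (D.index B κ)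

/-- A non-real eigenvalue whose real part is an eigenvalue is semisimple. -/
def SemisimpleAssumption (D : SpectralData A) : Prop :=
  ∀ κ, (D.μ κ).im ≠ 0 → (∃ ν, ((D.μ κ).re : ℂ) = D.μ ν) → D.Lam κ = 0

end SpectralData

/-- If the closure of the positively reachable cone contains `range [(e_k - e_ℓ) ⊗ I_n]`, then so
does the cone itself. -/
def ClosureAssumption {q p n : ℕ} (A : Matrix (Fin n) (Fin n) ℝ)
    (B : Fin q → Fin p → Fin n → ℝ) (k l : Fin q) : Prop :=
  Set.range (pairMatrix ℝ k l n).mulVec ⊆ closure (reachable A B) →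
    Set.range (pairMatrix ℝ k l n).mulVec ⊆ reachable A B

end RelArray

end

/-!
By linearity, and because the positively reachable sets are convex cones that grow with time,
positive `(k, l)`-controllability means that `range[(e_k - e_l) ⊗ I]` lies in the reachable cone.
The closure assumption and separation turn this into a dual statement: every `η` whose outputs
`∑ i, ⟪B_{iσ}, exp(t A*) η_i⟫` are nonnegative for all `t ≥ 0` and all `σ` has `η_k = η_l`.

The outputs are exponential polynomials. If such a function is nonnegative, then comparing its
Laplace transform near `z` and near `Re z`, for a rightmost exponent `z`, bounds the top
coefficient at `z` by the one at `Re z`; the growth is thus governed by a real eigenvalue with a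
nonnegative leading coefficient.

Sufficiency. Go through the eigenvalues in order. After a time shift, the mode of `η` at a real
eigenvalue lies in the dual of `cone[inc(Q)]`, hence pairs to zero with the columns in the
lineality space; the inputs that may see it are those removed from the index set. The remaining
inputs do not see the earlier modes, so the connectivity conditions apply mode by mode.

Necessity. At each real eigenvalue choose a functional that is nonnegative on the cone and strictly
positive on the columns outside its lineality space. Superposing these over the eigenvalues before
`μ_κ` gives a state whose outputs vanish on `I_κ` and, by semisimplicity, eventually dominate the
mode at `μ_κ` on all other inputs. Adding a small multiple of a mode orthogonal to the columns of
`inc(Q)` over `I_κ` therefore keeps the outputs eventually nonnegative.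
-/

noncomputable section

namespace RelArray

open Filter Topology

/-! ### Polyhedral cones -/

section Cone

variable {ρ ι : Type} [Fintype ι]

/-- `cone G` as an additive structure, so that the library on pointed cones applies to it. -/
def pointedCone (G : Matrix ρ ι ℝ) : PointedCone ℝ (ρ → ℝ) where
  carrier := cone G
  add_mem' := by
    rintro _ _ ⟨α, hα, rfl⟩ ⟨β, hβ, rfl⟩
    exact ⟨α + β, fun j => add_nonneg (hα j) (hβ j), (mulVec_add _ _ _).symm⟩
  zero_mem' := ⟨0, fun _ => le_rfl, (mulVec_zero _).symm⟩
  smul_mem' := by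
    rintro c _ ⟨α, hα, rfl⟩
    exact ⟨(c : ℝ) • α, fun j => mul_nonneg c.2 (hα j), (mulVec_smul _ _ _).symm⟩

lemma col_mem_cone (G : Matrix ρ ι ℝ) (j : ι) : G.col j ∈ cone G := by
  classical
  exact ⟨Pi.single j 1, (Pi.single_nonneg.2 zero_le_one : (0 : ι → ℝ) ≤ _),
    (mulVec_single_one G j).symm⟩

lemma exists_sub_smul_nonneg_support_ssubset {ι : Type*} [Finite ι] {α β : ι → ℝ} (hα : 0 ≤ α)
    (hβ : Function.support β ⊆ Function.support α) (hpos : ∃ j, 0 < β j) :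
    ∃ t : ℝ, 0 ≤ α - t • β ∧ Function.support (α - t • β) ⊂ Function.support α := by
  classical
  have := Fintype.ofFinite ι
  obtain ⟨j₁, hj₁⟩ := hpos
  obtain ⟨j₀, hj₀, hmin⟩ := Finset.exists_min_image {j | 0 < β j} (fun j => α j / β j)
    ⟨j₁, by simpa using hj₁⟩
  simp only [Finset.mem_filter, Finset.mem_univ, true_and] at hj₀ hmin
  have ht : 0 ≤ α j₀ / β j₀ := div_nonneg (hα j₀) hj₀.le
  refine ⟨α j₀ / β j₀, fun j => ?_, Set.ssubset_iff_exists.2 ⟨fun j hj => ?_, j₀, ?_, ?_⟩⟩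
  · simp only [Pi.zero_apply, Pi.sub_apply, Pi.smul_apply, smul_eq_mul, sub_nonneg]
    rcases lt_or_ge 0 (β j) with h | h
    · exact (le_div_iff₀ h).1 (hmin j h)
    · exact (mul_nonpos_of_nonneg_of_nonpos ht h).trans (hα j)
  · by_contra hαj
    exact hj (by simp [Function.notMem_support.1 hαj,
      Function.notMem_support.1 (mt (@hβ j) hαj)])
  · exact hβ hj₀.ne'
  · simp [hj₀.ne']

-- Conic Carathéodory theorem: a representation of minimal support uses independent columns.
lemma exists_eq_mulVec_of_mem_cone {G : Matrix ρ ι ℝ} {x : ρ → ℝ} (hx : x ∈ cone G) :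
    ∃ α : ι → ℝ, 0 ≤ α ∧ x = G *ᵥ α ∧
      ∀ β : ι → ℝ, Function.support β ⊆ Function.support α → G *ᵥ β = 0 → β = 0 := by
  obtain ⟨α, ⟨hα, hxα⟩, hmin⟩ := exists_minimalFor_of_wellFoundedLT
    (fun α : ι → ℝ => 0 ≤ α ∧ x = G *ᵥ α) Function.support hx
  refine ⟨α, hα, hxα, fun β hβ hGβ => ?_⟩
  have nonpos : ∀ γ : ι → ℝ, Function.support γ ⊆ Function.support α → G *ᵥ γ = 0 →
      ∀ j, γ j ≤ 0 := by
    by_contra! ⟨γ, hγ, hGγ, hpos⟩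
    obtain ⟨t, hnonneg, hlt⟩ := exists_sub_smul_nonneg_support_ssubset hα hγ hpos
    have hx' : x = G *ᵥ (α - t • γ) := by
      rw [mulVec_sub, mulVec_smul, hGγ, smul_zero, sub_zero, hxα]
    exact hlt.not_subset (hmin ⟨hnonneg, hx'⟩ hlt.subset)
  refine funext fun j => le_antisymm (nonpos β hβ hGβ j) (neg_nonpos.1 (nonpos (-β) ?_ ?_ j))
  · rwa [Function.support_neg]
  · rw [mulVec_neg, hGβ, neg_zero]

lemma isClosed_cone (G : Matrix ρ ι ℝ) : IsClosed (cone G) := by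
  let W : Set ι → Submodule ℝ (ι → ℝ) := fun s => Submodule.pi sᶜ fun _ => ⊥
  have hW : ∀ s (β : ι → ℝ), β ∈ W s ↔ Function.support β ⊆ s := fun s β => by
    simp only [W, Submodule.mem_pi, Submodule.mem_bot, Function.support_subset_iff']
    rfl
  have hunion : cone G = ⋃ s ∈ {s | ∀ β ∈ W s, G *ᵥ β = 0 → β = 0},
      (G.mulVecLin ∘ₗ (W s).subtype) '' {β | ∀ j, 0 ≤ (β : ι → ℝ) j} := by
    ext x
    simp only [Set.mem_iUnion, Set.mem_image]
    constructor
    · intro hx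
      obtain ⟨α, hα, rfl, hindep⟩ := exists_eq_mulVec_of_mem_cone hx
      exact ⟨Function.support α, fun β hβ => hindep β ((hW _ _).1 hβ),
        ⟨α, (hW _ _).2 subset_rfl⟩, hα, rfl⟩
    · rintro ⟨s, -, β, hβ, rfl⟩
      exact ⟨β, hβ, rfl⟩
  rw [hunion]
  refine Set.Finite.isClosed_biUnion (Set.toFinite _) fun s hs => ?_
  have hinj : LinearMap.ker (G.mulVecLin ∘ₗ (W s).subtype) = ⊥ :=
    LinearMap.ker_eq_bot'.2 fun β hβ => Subtype.ext (hs β β.2 hβ)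
  refine (LinearMap.isClosedEmbedding_of_injective hinj).isClosedMap _ ?_
  rw [Set.ofPred_forall]
  exact isClosed_iInter fun j => isClosed_le continuous_const
    ((continuous_apply j).comp continuous_subtype_val)

lemma mem_closure_iff_forall_dotProduct_nonneg (C : PointedCone ℝ (ι → ℝ)) {x : ι → ℝ} :
    x ∈ closure (C : Set (ι → ℝ)) ↔
      ∀ η : ι → ℝ, (∀ y ∈ C, 0 ≤ y ⬝ᵥ η) → 0 ≤ x ⬝ᵥ η := by
  classical
  constructor
  · intro hx η hη
    have hclosed : IsClosed {y : ι → ℝ | 0 ≤ y ⬝ᵥ η} :=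
      isClosed_le continuous_const (continuous_id.dotProduct continuous_const)
    exact closure_minimal (s := (C : Set (ι → ℝ))) hη hclosed hx
  · intro h
    by_contra hx
    let K : ProperCone ℝ (ι → ℝ) := ⟨C.closure, isClosed_closure⟩
    obtain ⟨f, hf, hfx⟩ := K.hyperplane_separation_point hx
    obtain ⟨η, hη⟩ := (dotProductEquiv ℝ ι).surjective (f : (ι → ℝ) →ₗ[ℝ] ℝ)
    have hfη : ∀ y, f y = y ⬝ᵥ η := fun y => by
      rw [dotProduct_comm]; exact (LinearMap.congr_fun hη y).symm
    simp only [hfη] at hf hfx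
    exact hfx.not_ge (h η fun y hy => hf y (subset_closure hy))

lemma mem_cone_iff_forall_dotProduct_nonneg [Fintype ρ] {G : Matrix ρ ι ℝ} {x : ρ → ℝ} :
    x ∈ cone G ↔ ∀ η : ρ → ℝ, (∀ j, 0 ≤ G.col j ⬝ᵥ η) → 0 ≤ x ⬝ᵥ η := by
  have hclosure : closure (pointedCone G : Set (ρ → ℝ)) = cone G := (isClosed_cone G).closure_eq
  rw [← hclosure, mem_closure_iff_forall_dotProduct_nonneg]
  refine forall_congr' fun η => imp_congr_left ⟨fun h j => h _ (col_mem_cone G j), ?_⟩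
  rintro h _ ⟨α, hα, rfl⟩
  rw [← vecMul_transpose, ← dotProduct_mulVec]
  exact Finset.sum_nonneg fun j _ => mul_nonneg (hα j) (h j)

/-- The lineality space of `cone G`: the largest linear subspace that it contains. -/
def linealitySpace (G : Matrix ρ ι ℝ) : Submodule ℝ (ρ → ℝ) :=
  sSup {S | (S : Set (ρ → ℝ)) ⊆ cone G}

lemma mem_linealitySpace_iff [Fintype ρ] {G : Matrix ρ ι ℝ} {x : ρ → ℝ} :
    x ∈ linealitySpace G ↔ ∀ η : ρ → ℝ, (∀ j, 0 ≤ G.col j ⬝ᵥ η) → x ⬝ᵥ η = 0 := by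
  classical
  constructor
  · intro hx η hη
    have hker : linealitySpace G ≤ LinearMap.ker (dotProductEquiv ℝ ρ η) := by
      refine sSup_le fun S hS y hy => ?_
      have hy₁ := mem_cone_iff_forall_dotProduct_nonneg.1 (hS hy) η hη
      have hy₂ := mem_cone_iff_forall_dotProduct_nonneg.1 (hS (S.neg_mem hy)) η hη
      rw [neg_dotProduct, neg_nonneg] at hy₂
      rw [LinearMap.mem_ker, dotProductEquiv_apply_apply, dotProduct_comm]
      exact le_antisymm hy₂ hy₁
    rw [dotProduct_comm]
    exact hker hx
  · intro h
    refine le_sSup (a := Submodule.span ℝ {x}) ?_ (Submodule.mem_span_singleton_self x)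
    intro y hy
    obtain ⟨c, rfl⟩ := Submodule.mem_span_singleton.1 hy
    refine mem_cone_iff_forall_dotProduct_nonneg.2 fun η hη => ?_
    rw [smul_dotProduct, h η hη, smul_zero]

lemma exists_forall_notMem_linealitySpace_dotProduct_pos [Fintype ρ] (G : Matrix ρ ι ℝ) :
    ∃ η : ρ → ℝ, (∀ j, 0 ≤ G.col j ⬝ᵥ η) ∧
      ∀ j, G.col j ∉ linealitySpace G → 0 < G.col j ⬝ᵥ η := by
  have hsingle : ∀ j, ∃ η : ρ → ℝ, (∀ i, 0 ≤ G.col i ⬝ᵥ η) ∧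
      (G.col j ∉ linealitySpace G → 0 < G.col j ⬝ᵥ η) := by
    intro j
    by_cases hj : G.col j ∈ linealitySpace G
    · exact ⟨0, fun i => (dotProduct_zero _).ge, fun h => absurd hj h⟩
    · have hj' := mt mem_linealitySpace_iff.2 hj
      push Not at hj'
      obtain ⟨η, hη, hne⟩ := hj'
      exact ⟨η, hη, fun _ => (hη j).lt_of_ne' hne⟩
  choose η hη hpos using hsingle
  refine ⟨∑ j, η j, fun i => ?_, fun i hi => ?_⟩
  · rw [dotProduct_sum]
    exact Finset.sum_nonneg fun j _ => hη j i
  · rw [dotProduct_sum]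
    exact Finset.sum_pos' (fun j _ => hη j i) ⟨i, Finset.mem_univ _, hpos i hi⟩

lemma exists_forall_mem_of_monotoneOn_cones {ι E : Type*} [Finite ι] [AddCommGroup E] [Module ℝ E]
    {C : ℝ → PointedCone ℝ E} (hC : ∀ s t, 0 ≤ s → s ≤ t → C s ≤ C t)
    (P : (ι → ℝ) →ₗ[ℝ] E) (h : ∀ v, ∃ τ, 0 ≤ τ ∧ P v ∈ C τ) :
    ∃ τ, 0 < τ ∧ ∀ v, P v ∈ C τ := by
  classical
  have := Fintype.ofFinite ι
  choose τ hτ hP using h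
  let S : ι → ℝ := fun j => τ (Pi.single j 1) + τ (-Pi.single j 1)
  have hS : ∀ j, 0 ≤ S j := fun j => add_nonneg (hτ _) (hτ _)
  have hST : ∀ j, S j ≤ 1 + ∑ i, S i := fun j =>
    (Finset.single_le_sum (fun i _ => hS i) (Finset.mem_univ j)).trans (by linarith)
  refine ⟨1 + ∑ j, S j, by linarith [Finset.sum_nonneg fun j (_ : j ∈ Finset.univ) => hS j],
    fun v => ?_⟩
  rw [pi_eq_sum_univ' v, map_sum]
  refine Submodule.sum_mem _ fun j _ => ?_
  rw [map_smul]
  rcases le_total 0 (v j) with hv | hv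
  · exact (C _).smul_mem hv (hC _ _ (hτ _)
      ((le_add_of_nonneg_right (hτ _)).trans (hST j)) (hP (Pi.single j 1)))
  · have hneg := (C _).smul_mem (neg_nonneg.2 hv) (hC _ _ (hτ _)
      ((le_add_of_nonneg_left (hτ _)).trans (hST j)) (hP (-Pi.single j 1)))
    rw [map_neg] at hneg
    convert! hneg using 1
    change _ = (-v j) • (-(P _))
    rw [neg_smul_neg]

end Cone

section Pair

variable {𝕜 : Type} [RCLike 𝕜] {q d : ℕ} {ι : Type} [Fintype ι]

lemma pairMatrix_mulVec (k l : Fin q) (w : Fin d → 𝕜) (i : Fin q) (a : Fin d) :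
    (pairMatrix 𝕜 k l d *ᵥ w) (i, a) =
      (Pi.single k (1 : 𝕜) - Pi.single l (1 : 𝕜) : Fin q → 𝕜) i * w a := by
  simp [pairMatrix, mulVec, dotProduct, one_apply]

lemma pairMatrix_mulVec_dotProduct (k l : Fin q) (w : Fin d → 𝕜) (v : Fin q × Fin d → 𝕜) :
    (pairMatrix 𝕜 k l d *ᵥ w) ⬝ᵥ v = w ⬝ᵥ fun a => v (k, a) - v (l, a) := by
  rw [dotProduct, Fintype.sum_prod_type_right]
  refine Finset.sum_congr rfl fun a _ => ?_
  simp only [pairMatrix_mulVec, Pi.sub_apply, sub_mul, Finset.sum_sub_distrib, mul_sub]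
  congr 1 <;> simp [Pi.single_apply]

lemma forall_pairMatrix_mulVec_dotProduct_nonneg_iff {k l : Fin q} {v : Fin q × Fin d → ℝ} :
    (∀ w, 0 ≤ (pairMatrix ℝ k l d *ᵥ w) ⬝ᵥ v) ↔ ∀ a, v (k, a) = v (l, a) := by
  simp only [pairMatrix_mulVec_dotProduct]
  constructor
  · intro h a
    have hpos := h (Pi.single a 1)
    have hneg := h (-Pi.single a 1)
    rw [neg_dotProduct] at hneg
    rw [single_one_dotProduct] at hpos hneg
    linarith
  · intro h w
    simp only [h, sub_self]
    exact (dotProduct_zero w).ge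

lemma range_pairMatrix_subset_closure_iff (C : PointedCone ℝ (Fin q × Fin d → ℝ)) {k l : Fin q} :
    Set.range (pairMatrix ℝ k l d).mulVec ⊆ closure (C : Set (Fin q × Fin d → ℝ)) ↔
      ∀ η : Fin q × Fin d → ℝ, (∀ y ∈ C, 0 ≤ y ⬝ᵥ η) → ∀ a, η (k, a) = η (l, a) := by
  simp only [Set.range_subset_iff, mem_closure_iff_forall_dotProduct_nonneg]
  rw [forall_comm]
  refine forall_congr' fun η => ?_
  rw [forall_comm, forall_pairMatrix_mulVec_dotProduct_nonneg_iff]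

lemma range_pairMatrix_subset_cone_iff {G : Matrix (Fin q × Fin d) ι ℝ} {k l : Fin q} :
    Set.range (pairMatrix ℝ k l d).mulVec ⊆ cone G ↔
      ∀ η : Fin q × Fin d → ℝ, (∀ j, 0 ≤ G.col j ⬝ᵥ η) → ∀ a, η (k, a) = η (l, a) := by
  simp only [Set.range_subset_iff, mem_cone_iff_forall_dotProduct_nonneg]
  rw [forall_comm]
  refine forall_congr' fun η => ?_
  rw [forall_comm, forall_pairMatrix_mulVec_dotProduct_nonneg_iff]

lemma mem_range_mulVec_iff {ρ : Type*} [Fintype ρ] {G : Matrix ρ ι 𝕜} {x : ρ → 𝕜} :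
    x ∈ Set.range G.mulVec ↔ ∀ ζ : ρ → 𝕜, ζ ᵥ* G = 0 → ζ ⬝ᵥ x = 0 := by
  classical
  constructor
  · rintro ⟨y, rfl⟩ ζ hζ
    rw [dotProduct_mulVec, hζ, zero_dotProduct]
  · intro h
    by_contra hx
    obtain ⟨f, hf, hker⟩ := Submodule.exists_le_ker_of_notMem (p := LinearMap.range G.mulVecLin)
      (v := x) hx
    obtain ⟨ζ, rfl⟩ := (dotProductEquiv 𝕜 ρ).surjective f
    refine hf (h ζ (funext fun j => ?_))
    have hcol : ζ ⬝ᵥ G *ᵥ Pi.single j 1 = 0 := hker ⟨Pi.single j 1, rfl⟩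
    rwa [dotProduct_mulVec, dotProduct_single_one] at hcol

lemma pairConnected_iff {G : Matrix (Fin q × Fin d) ι ℂ} {k l : Fin q} :
    PairConnected G k l ↔
      ∀ ζ : Fin q × Fin d → ℂ, Gᴴ *ᵥ ζ = 0 → ∀ a, ζ (k, a) = ζ (l, a) := by
  have hstar : ∀ ζ : Fin q × Fin d → ℂ, star ζ ᵥ* G = 0 ↔ Gᴴ *ᵥ ζ = 0 := fun ζ => by
    rw [← star_inj, star_vecMul, star_star, star_zero]
  simp only [PairConnected, Set.range_subset_iff, mem_range_mulVec_iff]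
  rw [forall_comm, star_involutive.surjective.forall]
  refine forall_congr' fun ζ => ?_
  rw [forall_comm, hstar]
  refine imp_congr_right fun _ => ?_
  simp only [dotProduct_comm (star ζ), pairMatrix_mulVec_dotProduct]
  constructor
  · intro h a
    have ha := h (Pi.single a 1)
    rw [single_one_dotProduct, Pi.star_apply, Pi.star_apply] at ha
    exact star_injective (sub_eq_zero.1 ha)
  · intro h w
    simp only [Pi.star_apply, h, sub_self]
    exact dotProduct_zero w

end Pair

/-! ### Nonnegative exponential polynomials -/

section ExpPoly

variable {κ : Type*} [Fintype κ]

/-- The exponential polynomial `∑_ν ∑_{r < N} a_{νr} (t^r / r!) e^{μ_ν t}`. The factorials turn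
Laplace transforms and matrix exponentials into expressions without constants. -/
def expPoly (μ : κ → ℂ) (N : ℕ) (a : κ → ℕ → ℂ) (t : ℝ) : ℂ :=
  ∑ ν, ∑ r ∈ Finset.range N, a ν r * ((t : ℂ) ^ r / r.factorial * Complex.exp (μ ν * t))

/-- The coefficient of `(t^r / r!) e^{zt}` in an exponential polynomial with exponents `μ`; it is
`0` if `z` is not one of the exponents. -/
def coeffAt (μ : κ → ℂ) (a : κ → ℕ → ℂ) (z : ℂ) (r : ℕ) : ℂ :=
  ∑ ν, if μ ν = z then a ν r else 0

lemma coeffAt_apply_of_injective {μ : κ → ℂ} (hμ : Function.Injective μ) (a : κ → ℕ → ℂ) (ν : κ)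
    (r : ℕ) : coeffAt μ a (μ ν) r = a ν r := by
  classical
  simp [coeffAt, hμ.eq_iff]

lemma coeffAt_sub (μ : κ → ℂ) (a : κ → ℕ → ℂ) (z : ℂ) (r : ℕ) :
    coeffAt (fun ν => μ ν - z) a 0 r = coeffAt μ a z r := by
  simp only [coeffAt, sub_eq_zero]

lemma cexp_neg_mul_expPoly (μ : κ → ℂ) (N : ℕ) (a : κ → ℕ → ℂ) (z : ℂ) (t : ℝ) :
    Complex.exp (-z * t) * expPoly μ N a t = expPoly (fun ν => μ ν - z) N a t := by
  simp only [expPoly, Finset.mul_sum]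
  refine Finset.sum_congr rfl fun ν _ => Finset.sum_congr rfl fun r _ => ?_
  rw [show (μ ν - z) * (t : ℂ) = -z * t + μ ν * t by ring, Complex.exp_add]
  ring

lemma integrableOn_pow_mul_cexp (r : ℕ) {z : ℂ} (hz : z.re < 0) :
    IntegrableOn (fun t : ℝ => (t : ℂ) ^ r / r.factorial * Complex.exp (z * t)) (Set.Ioi 0) := by
  have hreal := (integrableOn_rpow_mul_exp_neg_mul_rpow (p := 1) (s := r) (b := -z.re)
    (neg_one_lt_zero.trans_le (Nat.cast_nonneg r)) one_pos (by linarith)).div_const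
      (r.factorial : ℝ)
  refine hreal.mono' (by fun_prop) ?_
  filter_upwards [ae_restrict_mem measurableSet_Ioi] with t (ht : 0 < t)
  simp [Complex.norm_exp, abs_of_pos ht, div_mul_eq_mul_div]

lemma hasDerivAt_pow_mul_cexp (r : ℕ) (z : ℂ) (t : ℝ) :
    HasDerivAt (fun t : ℝ => (t : ℂ) ^ (r + 1) / (r + 1).factorial * Complex.exp (z * t))
      ((t : ℂ) ^ r / r.factorial * Complex.exp (z * t) +
        z * ((t : ℂ) ^ (r + 1) / (r + 1).factorial * Complex.exp (z * t))) t := by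
  have hpow : HasDerivAt (fun t : ℂ => t ^ (r + 1) / (r + 1).factorial)
      ((t : ℂ) ^ r / r.factorial) t := by
    convert! (hasDerivAt_pow (r + 1) (t : ℂ)).div_const ((r + 1).factorial : ℂ) using 1
    have hr : (r : ℂ) + 1 ≠ 0 := Nat.cast_add_one_ne_zero r
    have hfact : (r.factorial : ℂ) ≠ 0 := Nat.cast_ne_zero.2 r.factorial_ne_zero
    rw [Nat.factorial_succ]
    push_cast
    field_simp
  have hexp : HasDerivAt (fun t : ℂ => Complex.exp (z * t)) (Complex.exp (z * t) * z) t := by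
    simpa using ((hasDerivAt_id (t : ℂ)).const_mul z).cexp
  convert! (hpow.mul hexp).comp_ofReal using 1
  ring

lemma integral_pow_mul_cexp (r : ℕ) {z : ℂ} (hz : z.re < 0) :
    ∫ t : ℝ in Set.Ioi 0, (t : ℂ) ^ r / r.factorial * Complex.exp (z * t) =
      1 / (-z) ^ (r + 1) := by
  have hz₀ : z ≠ 0 := by rintro rfl; exact lt_irrefl _ hz
  induction r with
  | zero => simpa [neg_div] using integral_exp_mul_complex_Ioi hz 0
  | succ r ih =>
    have hint := integrableOn_pow_mul_cexp r hz
    have hint' := integrableOn_pow_mul_cexp (r + 1) hz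
    have hderiv := fun (t : ℝ) (_ : t ∈ Set.Ici 0) => hasDerivAt_pow_mul_cexp r z t
    have hlim := tendsto_zero_of_hasDerivAt_of_integrableOn_Ioi
      (fun t ht => hderiv t (Set.Ioi_subset_Ici_self ht)) (hint.add (hint'.const_mul z)) hint'
    have hparts := integral_Ioi_of_hasDerivAt_of_tendsto' hderiv
      (hint.add (hint'.const_mul z)) hlim
    rw [integral_add hint (hint'.const_mul z), integral_const_mul, ih, Complex.ofReal_zero,
      zero_pow r.succ_ne_zero, zero_div, zero_mul, sub_zero] at hparts
    rw [pow_succ (-z) (r + 1), ← div_div, eq_div_iff (neg_ne_zero.2 hz₀)]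
    linear_combination -hparts

lemma integrableOn_expPoly {μ : κ → ℂ} {a : κ → ℕ → ℂ}
    (hre : ∀ ν, 0 ≤ (μ ν).re → ∀ r, a ν r = 0) (N : ℕ) :
    IntegrableOn (expPoly μ N a) (Set.Ioi 0) := by
  refine integrable_finsetSum _ fun ν _ => integrable_finsetSum _ fun r _ => ?_
  rcases lt_or_ge (μ ν).re 0 with hν | hν
  · exact (integrableOn_pow_mul_cexp r hν).const_mul _
  · simp [hre ν hν]

lemma integral_expPoly {μ : κ → ℂ} {a : κ → ℕ → ℂ} (hre : ∀ ν, 0 ≤ (μ ν).re → ∀ r, a ν r = 0)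
    (N : ℕ) : ∫ t in Set.Ioi 0, expPoly μ N a t =
      ∑ ν, ∑ r ∈ Finset.range N, a ν r * (1 / (-μ ν) ^ (r + 1)) := by
  have hterm : ∀ ν r, IntegrableOn (fun t : ℝ => a ν r * ((t : ℂ) ^ r / r.factorial *
      Complex.exp (μ ν * t))) (Set.Ioi 0) := by
    intro ν r
    rcases lt_or_ge (μ ν).re 0 with hν | hν
    · exact (integrableOn_pow_mul_cexp r hν).const_mul _
    · simp [hre ν hν]
  simp only [expPoly]
  rw [integral_finsetSum _ fun ν _ => integrable_finsetSum _ fun r _ => hterm ν r]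
  refine Finset.sum_congr rfl fun ν _ => ?_
  rw [integral_finsetSum _ fun r _ => hterm ν r]
  refine Finset.sum_congr rfl fun r _ => ?_
  rcases lt_or_ge (μ ν).re 0 with hν | hν
  · rw [integral_const_mul, integral_pow_mul_cexp r hν]
  · simp [hre ν hν]

lemma tendsto_pow_div_sub_pow {w c : ℂ} {r d : ℕ} (hc : w = 0 → d < r → c = 0) :
    Tendsto (fun s : ℝ => (s : ℂ) ^ (d + 1) * (c * (1 / ((s : ℂ) - w) ^ (r + 1)))) (𝓝[>] 0)
      (𝓝 (if w = 0 ∧ r = d then c else 0)) := by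
  by_cases hw : w = 0
  · rcases lt_or_ge d r with hdr | hrd
    · simp [hc hw hdr]
    have hpow : Tendsto (fun s : ℝ => c * (s : ℂ) ^ (d - r)) (𝓝[>] 0)
        (𝓝 (c * ((0 : ℝ) : ℂ) ^ (d - r))) :=
      (Continuous.tendsto (by fun_prop) _).mono_left nhdsWithin_le_nhds
    have hval : c * ((0 : ℝ) : ℂ) ^ (d - r) = if w = 0 ∧ r = d then c else 0 := by
      rcases hrd.eq_or_lt with rfl | hlt
      · simp [hw]
      · simp [hlt.ne, Nat.sub_ne_zero_of_lt hlt]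
    rw [← hval]
    refine hpow.congr' ?_
    filter_upwards [self_mem_nhdsWithin] with s (hs : 0 < s)
    have hs' : (s : ℂ) ≠ 0 := Complex.ofReal_ne_zero.2 hs.ne'
    rw [hw, sub_zero, show d + 1 = (d - r) + (r + 1) by omega, pow_add]
    field_simp
  · have hcont : ContinuousAt
        (fun s : ℝ => (s : ℂ) ^ (d + 1) * (c * (1 / ((s : ℂ) - w) ^ (r + 1)))) 0 := by
      refine ContinuousAt.mul (by fun_prop) (continuousAt_const.mul
        (ContinuousAt.div (by fun_prop) (by fun_prop) ?_))
      simp [hw]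
    simpa [hw] using hcont.tendsto.mono_left (nhdsWithin_le_nhds (s := Set.Ioi 0))

lemma tendsto_pow_mul_integral_expPoly {μ : κ → ℂ} {N : ℕ} {a : κ → ℕ → ℂ} {d : ℕ}
    (ha : ∀ ν r, N ≤ r → a ν r = 0) (hre : ∀ ν, 0 < (μ ν).re → ∀ r, a ν r = 0)
    (hd : ∀ ν, μ ν = 0 → ∀ r, d < r → a ν r = 0) :
    Tendsto (fun s : ℝ => (s : ℂ) ^ (d + 1) *
        ∫ t in Set.Ioi 0, expPoly (fun ν => μ ν - s) N a t)
      (𝓝[>] 0) (𝓝 (coeffAt μ a 0 d)) := by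
  have hlim := tendsto_finsetSum Finset.univ fun ν _ => tendsto_finsetSum (Finset.range N)
    fun r _ => tendsto_pow_div_sub_pow (w := μ ν) (c := a ν r) (r := r) (d := d)
      fun hν hr => hd ν hν r hr
  have hcoeff : (∑ ν, ∑ r ∈ Finset.range N, if μ ν = 0 ∧ r = d then a ν r else 0) =
      coeffAt μ a 0 d := by
    refine Finset.sum_congr rfl fun ν _ => ?_
    by_cases hν : μ ν = 0
    · simp only [hν, true_and, if_true, Finset.sum_ite_eq', Finset.mem_range]
      exact ite_eq_left_iff.2 fun hN => (ha ν d (not_lt.1 hN)).symm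
    · simp [hν]
  rw [← hcoeff]
  refine hlim.congr' ?_
  filter_upwards [self_mem_nhdsWithin] with s (hs : 0 < s)
  have hre' : ∀ ν, 0 ≤ (μ ν - s).re → ∀ r, a ν r = 0 := fun ν hν => hre ν (by
    rw [Complex.sub_re, Complex.ofReal_re] at hν
    linarith)
  rw [integral_expPoly hre']
  simp only [Finset.mul_sum, neg_sub]

open scoped ComplexOrder in
lemma norm_integral_expPoly_sub_le {μ : κ → ℂ} {N : ℕ} {a : κ → ℕ → ℂ}
    (hf : ∀ t, 0 ≤ t → 0 ≤ expPoly μ N a t) {z : ℂ} (hz : ∀ ν, z.re ≤ (μ ν).re → ∀ r, a ν r = 0) :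
    ‖∫ t in Set.Ioi 0, expPoly (fun ν => μ ν - z) N a t‖ ≤
      (∫ t in Set.Ioi 0, expPoly (fun ν => μ ν - z.re) N a t).re := by
  have hre : (∫ t in Set.Ioi 0, expPoly (fun ν => μ ν - z.re) N a t).re =
      ∫ t in Set.Ioi 0, (expPoly (fun ν => μ ν - z.re) N a t).re :=
    (integral_re (integrableOn_expPoly (by simpa using hz) N)).symm
  rw [hre]
  refine (norm_integral_le_integral_norm _).trans_eq
    (setIntegral_congr_fun measurableSet_Ioi fun t (ht : 0 < t) => ?_)
  have hnonneg : 0 ≤ expPoly (fun ν => μ ν - z.re) N a t := by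
    rw [← cexp_neg_mul_expPoly, ← Complex.ofReal_neg, ← Complex.ofReal_mul, ← Complex.ofReal_exp]
    exact mul_nonneg (Complex.zero_le_real.2 (Real.exp_pos _).le) (hf t ht.le)
  change ‖_‖ = _
  rw [Complex.re_eq_norm.2 hnonneg, ← cexp_neg_mul_expPoly, ← cexp_neg_mul_expPoly, norm_mul,
    norm_mul, Complex.norm_exp, Complex.norm_exp]
  simp

open scoped ComplexOrder in
-- Compare the asymptotics of the Laplace transform at `z + s` and at `Re z + s` as `s ↓ 0`.
theorem norm_coeffAt_le_of_nonneg {μ : κ → ℂ} {N : ℕ} {a : κ → ℕ → ℂ} {z : ℂ} {d : ℕ}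
    (ha : ∀ ν r, N ≤ r → a ν r = 0) (hf : ∀ t, 0 ≤ t → 0 ≤ expPoly μ N a t)
    (hz : ∀ ν, z.re < (μ ν).re → ∀ r, a ν r = 0)
    (hd : ∀ ν, (μ ν).re = z.re → ∀ r, d < r → a ν r = 0) :
    ‖coeffAt μ a z d‖ ≤ (coeffAt μ a z.re d).re := by
  have hlim : ∀ w : ℂ, w.re = z.re → Tendsto (fun s : ℝ => (s : ℂ) ^ (d + 1) *
      ∫ t in Set.Ioi 0, expPoly (fun ν => μ ν - w - s) N a t) (𝓝[>] 0)
      (𝓝 (coeffAt μ a w d)) := by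
    intro w hw
    rw [← coeffAt_sub]
    refine tendsto_pow_mul_integral_expPoly ha (fun ν hν => hz ν ?_) fun ν hν => hd ν ?_
    · rwa [Complex.sub_re, sub_pos, hw] at hν
    · rw [sub_eq_zero.1 hν, hw]
  refine le_of_tendsto_of_tendsto (hlim z rfl).norm
    ((Complex.continuous_re.tendsto _).comp (hlim z.re rfl)) ?_
  filter_upwards [self_mem_nhdsWithin] with s (hs : 0 < s)
  rw [Function.comp_apply, ← Complex.ofReal_pow, Complex.re_ofReal_mul, norm_mul,
    Complex.norm_of_nonneg (pow_nonneg hs.le _)]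
  refine mul_le_mul_of_nonneg_left ?_ (pow_nonneg hs.le _)
  have hz' : ∀ ν, (z + s).re ≤ (μ ν).re → ∀ r, a ν r = 0 := fun ν hν => hz ν (by
    rw [Complex.add_re, Complex.ofReal_re] at hν
    linarith)
  simpa [sub_sub] using norm_integral_expPoly_sub_le hf hz'

open scoped ComplexOrder in
theorem coeff_eq_zero_of_nonneg {μ : κ → ℂ} (hμ : Function.Injective μ) {N : ℕ} {a : κ → ℕ → ℂ}
    {α : ℝ} {d : ℕ} (ha : ∀ ν r, N ≤ r → a ν r = 0) (hf : ∀ t, 0 ≤ t → 0 ≤ expPoly μ N a t)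
    (hα : ∀ ν, α < (μ ν).re → ∀ r, a ν r = 0) (hd : ∀ r, d ≤ r → (coeffAt μ a α r).re = 0)
    (ν : κ) (hν : (μ ν).re = α) (r : ℕ) (hr : d ≤ r) : a ν r = 0 := by
  obtain ⟨j, hj⟩ : ∃ j, N ≤ d + j := ⟨N, Nat.le_add_left _ _⟩
  induction j generalizing d r ν with
  | zero => exact ha ν r (by omega)
  | succ j ih =>
    have hnext : ∀ ν, (μ ν).re = α → ∀ r, d < r → a ν r = 0 := fun ν hν r hr =>
      ih (d := d + 1) (fun r hr => hd r (by omega)) ν hν r hr (by omega)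
    rcases hr.eq_or_lt with rfl | hlt
    · have hnorm := norm_coeffAt_le_of_nonneg (z := μ ν) (d := d) ha hf (by rwa [hν])
        (by rwa [hν])
      rw [hν, hd d le_rfl, coeffAt_apply_of_injective hμ] at hnorm
      exact norm_le_zero_iff.1 hnorm
    · exact hnext ν hν r hlt

open scoped ComplexOrder in
theorem coeffAt_nonneg_of_nonneg {μ : κ → ℂ} (hμ : Function.Injective μ) {N : ℕ} {a : κ → ℕ → ℂ}
    {α : ℝ} {d : ℕ} (ha : ∀ ν r, N ≤ r → a ν r = 0) (hf : ∀ t, 0 ≤ t → 0 ≤ expPoly μ N a t)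
    (hα : ∀ ν, α < (μ ν).re → ∀ r, a ν r = 0) (hd : ∀ r, d < r → (coeffAt μ a α r).re = 0) :
    0 ≤ (coeffAt μ a α d).re :=
  (norm_nonneg _).trans (norm_coeffAt_le_of_nonneg (z := α) ha hf hα
    fun ν hν r hr => coeff_eq_zero_of_nonneg hμ (d := d + 1) ha hf hα hd ν hν r hr)

lemma eventually_sum_pow_nonneg {b : ℕ → ℝ} {N : ℕ} (hN : ∀ s, N ≤ s → b s = 0)
    (hlead : ∀ d, (∀ s, d < s → b s = 0) → 0 ≤ b d) :
    ∀ᶠ t : ℝ in atTop, 0 ≤ ∑ s ∈ Finset.range N, t ^ s / s.factorial * b s := by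
  let P : Polynomial ℝ := ∑ s ∈ Finset.range N, Polynomial.monomial s (b s / s.factorial)
  have heval : ∀ t, P.eval t = ∑ s ∈ Finset.range N, t ^ s / s.factorial * b s := fun t => by
    simp only [P, Polynomial.eval_finsetSum, Polynomial.eval_monomial]
    exact Finset.sum_congr rfl fun s _ => by ring
  have hcoeff : ∀ s, P.coeff s = b s / s.factorial := fun s => by
    simp only [P, Polynomial.finsetSum_coeff, Polynomial.coeff_monomial, Finset.sum_ite_eq',
      Finset.mem_range]
    exact ite_eq_left_iff.2 fun hs => by rw [hN s (not_lt.1 hs), zero_div]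
  have hnonneg : 0 ≤ P.leadingCoeff := by
    rw [Polynomial.leadingCoeff, hcoeff]
    refine div_nonneg (hlead _ fun s hs => ?_) (Nat.cast_nonneg _)
    have hs' := Polynomial.coeff_eq_zero_of_natDegree_lt hs
    rw [hcoeff] at hs'
    exact (div_eq_zero_iff.1 hs').resolve_right (Nat.cast_ne_zero.2 s.factorial_ne_zero)
  simp only [← heval]
  rcases lt_or_ge 0 P.degree with hdeg | hdeg
  · exact (P.tendsto_atTop_of_leadingCoeff_nonneg hdeg hnonneg).eventually_ge_atTop 0
  · rw [Polynomial.eq_C_of_degree_le_zero hdeg, Polynomial.leadingCoeff_C] at hnonneg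
    rw [Polynomial.eq_C_of_degree_le_zero hdeg]
    simp only [Polynomial.eval_C]
    exact Eventually.of_forall fun _ => hnonneg

end ExpPoly

/-! ### Matrix exponentials -/

section MatrixExp

variable {𝕜 m : Type*} [RCLike 𝕜] [Fintype m] [DecidableEq m]

section
open scoped Matrix.Norms.Operator

lemma exp_smul_mulVec_of_pow_mulVec_eq_zero (M : Matrix m m 𝕜) (v : m → 𝕜) (N : ℕ)
    (h : ∀ r, N ≤ r → M ^ r *ᵥ v = 0) (t : 𝕜) :
    NormedSpace.exp (t • M) *ᵥ v =
      ∑ r ∈ Finset.range N, (t ^ r / (r.factorial : 𝕜)) • (M ^ r *ᵥ v) := by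
  have hseries := (NormedSpace.exp_series_hasSum_exp' (𝕂 := 𝕜) (t • M)).map
    ((Matrix.mulVecBilin 𝕜 𝕜).flip v : Matrix m m 𝕜 →ₗ[𝕜] m → 𝕜)
    (Continuous.matrix_mulVec continuous_id continuous_const)
  have hterm : ∀ r : ℕ, (((r.factorial : 𝕜)⁻¹) • (t • M) ^ r) *ᵥ v =
      (t ^ r / (r.factorial : 𝕜)) • (M ^ r *ᵥ v) := fun r => by
    rw [smul_pow, smul_smul, smul_mulVec, inv_mul_eq_div]
  simp only [Function.comp_def, LinearMap.flip_apply, mulVecBilin_apply, hterm] at hseries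
  refine hseries.unique (hasSum_sum_of_ne_finset_zero fun r hr => ?_)
  rw [h r (by simpa using hr), smul_zero]

lemma continuous_exp_smul (M : Matrix m m 𝕜) :
    Continuous fun t : ℝ => NormedSpace.exp (t • M) :=
  NormedSpace.exp_continuous.comp (by fun_prop)

lemma exp_map_ofReal (M : Matrix m m ℝ) :
    NormedSpace.exp (M.map Complex.ofReal) = (NormedSpace.exp M).map Complex.ofReal :=
  (NormedSpace.map_exp (Complex.ofRealHom.mapMatrix : Matrix m m ℝ →+* Matrix m m ℂ)
    (continuous_id.matrix_map Complex.continuous_ofReal) M).symm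

lemma exp_bigA (q : ℕ) {n : ℕ} (A : Matrix (Fin n) (Fin n) ℝ) :
    NormedSpace.exp (bigA q A) = bigA q (NormedSpace.exp A) := by
  let f : Matrix (Fin n) (Fin n) ℝ →+* Matrix (Fin q × Fin n) (Fin q × Fin n) ℝ :=
    { toFun := bigA q
      map_one' := one_kronecker_one
      map_mul' := fun X Y => by simp only [bigA, ← mul_kronecker_mul, mul_one]
      map_zero' := kronecker_zero _
      map_add' := fun X Y => kronecker_add _ _ _ }
  have hf : Continuous f := continuous_matrix fun i j =>
    continuous_const.mul (continuous_id.matrix_elem i.2 j.2)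
  exact (NormedSpace.map_exp f hf A).symm

end

lemma exp_add_smul (M : Matrix m m 𝕜) (s t : ℝ) :
    NormedSpace.exp ((s + t) • M) = NormedSpace.exp (s • M) * NormedSpace.exp (t • M) := by
  rw [add_smul, Matrix.exp_add_of_commute]
  exact ((Commute.refl M).smul_left s).smul_right t

lemma exp_neg_smul_mul_exp_smul (M : Matrix m m 𝕜) (t : ℝ) :
    NormedSpace.exp (-t • M) * NormedSpace.exp (t • M) = 1 := by
  rw [← exp_add_smul, neg_add_cancel, zero_smul, NormedSpace.exp_zero]

lemma exp_smul_mulVec_injective (M : Matrix m m 𝕜) (t : ℝ) :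
    Function.Injective (NormedSpace.exp (t • M)).mulVec :=
  Function.LeftInverse.injective (g := (NormedSpace.exp (-t • M)).mulVec) fun v => by
    rw [mulVec_mulVec, exp_neg_smul_mul_exp_smul, one_mulVec]

lemma pow_mulVec_dotProduct_exp_mulVec (M : Matrix m m 𝕜) {N : ℕ} (hN : ∀ r, N ≤ r → M ^ r = 0)
    (b v : m → 𝕜) (t : 𝕜) (r : ℕ) :
    (M ^ r *ᵥ b) ⬝ᵥ (NormedSpace.exp (t • Mᵀ) *ᵥ v) =
      ∑ s ∈ Finset.range N, t ^ s / (s.factorial : 𝕜) * ((M ^ (r + s) *ᵥ b) ⬝ᵥ v) := by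
  rw [exp_smul_mulVec_of_pow_mulVec_eq_zero Mᵀ v N, dotProduct_sum]
  · refine Finset.sum_congr rfl fun s _ => ?_
    rw [dotProduct_smul, smul_eq_mul, add_comm, pow_add, ← mulVec_mulVec, dotProduct_mulVec,
      ← transpose_pow, vecMul_transpose]
  · intro s hs
    rw [← transpose_pow, hN s hs, transpose_zero, zero_mulVec]

end MatrixExp

/-! ### Spectral decomposition -/

namespace SpectralData

variable {q p n : ℕ} {A : Matrix (Fin n) (Fin n) ℝ} (D : SpectralData A)

lemma mult_le (κ : Fin D.m) : D.mult κ ≤ n := by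
  have hdeg : (adj A).charpoly.rootMultiplicity (D.μ κ) ≤ (adj A).charpoly.natDegree := by
    rw [← Polynomial.count_roots]
    exact (Multiset.count_le_card _ _).trans (Polynomial.card_roots' _)
  simpa [mult, algMult, charpoly_natDegree_eq_dim] using hdeg

lemma U_mulVec_injective (κ : Fin D.m) : Function.Injective (D.U κ).mulVec :=
  mulVec_injective_iff.2 (D.U_linearIndependent κ)

lemma U_mul_injective (κ : Fin D.m) {ι : Type*} [Finite ι] :
    Function.Injective fun X : Matrix (Fin (D.mult κ)) ι ℂ => D.U κ * X := fun X Y hXY => by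
  classical
  have := Fintype.ofFinite ι
  refine ext_of_mulVec_single fun j => D.U_mulVec_injective κ ?_
  simpa only [mulVec_mulVec] using congrArg (· *ᵥ Pi.single j 1) hXY

lemma Lam_conjTranspose (κ : Fin D.m) : (D.Lam κ)ᴴ = (D.Ared κ)ᴴ - D.μ κ • 1 :=
  conjTranspose_conjTranspose _

lemma pow_mul_U (κ : Fin D.m) (r : ℕ) :
    (adj A - D.μ κ • (1 : Matrix (Fin n) (Fin n) ℂ)) ^ r * D.U κ = D.U κ * (D.Lam κ)ᴴ ^ r := by
  have hU : (adj A - D.μ κ • 1) * D.U κ = D.U κ * (D.Lam κ)ᴴ := by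
    rw [Lam_conjTranspose, Matrix.sub_mul, Matrix.mul_sub, D.Ared_spec, Matrix.smul_mul,
      Matrix.mul_smul, Matrix.one_mul, Matrix.mul_one]
  induction r with
  | zero => rw [pow_zero, pow_zero, Matrix.one_mul, Matrix.mul_one]
  | succ r ih => rw [pow_succ', Matrix.mul_assoc, ih, ← Matrix.mul_assoc, hU, Matrix.mul_assoc,
      ← pow_succ']

lemma Lam_conjTranspose_pow_eq_zero (κ : Fin D.m) {r : ℕ} (hr : D.mult κ ≤ r) :
    (D.Lam κ)ᴴ ^ r = 0 := by
  refine pow_eq_zero_of_le hr (D.U_mul_injective κ ?_)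
  change D.U κ * (D.Lam κ)ᴴ ^ D.mult κ = D.U κ * 0
  rw [← pow_mul_U, Matrix.mul_zero]
  refine ext_of_mulVec_single fun j => ?_
  have hker : D.U κ *ᵥ Pi.single j 1 ∈ LinearMap.range (D.U κ).mulVecLin := ⟨_, rfl⟩
  rw [D.U_range] at hker
  rw [← mulVec_mulVec, zero_mulVec]
  exact hker

lemma Lam_pow_eq_zero (κ : Fin D.m) {r : ℕ} (hr : D.mult κ ≤ r) : D.Lam κ ^ r = 0 := by
  rw [← conjTranspose_eq_zero, conjTranspose_pow, D.Lam_conjTranspose_pow_eq_zero κ hr]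

lemma exp_mulVec_U (κ : Fin D.m) (z : Fin (D.mult κ) → ℂ) (t : ℝ) :
    NormedSpace.exp (t • adj A) *ᵥ (D.U κ *ᵥ z) = ∑ r ∈ Finset.range n,
      ((t : ℂ) ^ r / r.factorial * Complex.exp (D.μ κ * t)) •
        (D.U κ *ᵥ ((D.Lam κ)ᴴ ^ r *ᵥ z)) := by
  set M := adj A - D.μ κ • (1 : Matrix (Fin n) (Fin n) ℂ) with hM
  have hsplit : t • adj A = (t : ℂ) • M + (D.μ κ * t) • (1 : Matrix (Fin n) (Fin n) ℂ) := by
    rw [hM, smul_sub, smul_smul, mul_comm (t : ℂ), sub_add_cancel, Complex.coe_smul]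
  have hscalar : NormedSpace.exp ((D.μ κ * t) • (1 : Matrix (Fin n) (Fin n) ℂ)) =
      Complex.exp (D.μ κ * t) • 1 := by
    rw [smul_one_eq_diagonal, Matrix.exp_diagonal, smul_one_eq_diagonal]
    congr 1
    ext i
    rw [Pi.coe_exp, Complex.exp_eq_exp_ℂ]
  have hnil : ∀ r, n ≤ r → M ^ r *ᵥ (D.U κ *ᵥ z) = 0 := fun r hr => by
    rw [mulVec_mulVec, pow_mul_U, D.Lam_conjTranspose_pow_eq_zero κ ((D.mult_le κ).trans hr),
      Matrix.mul_zero, zero_mulVec]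
  rw [hsplit, Matrix.exp_add_of_commute _ _ ((Commute.one_right _).smul_right _), hscalar,
    Matrix.mul_smul, Matrix.mul_one, smul_mulVec, exp_smul_mulVec_of_pow_mulVec_eq_zero M _ n hnil,
    Finset.smul_sum]
  refine Finset.sum_congr rfl fun r _ => ?_
  rw [smul_smul, mulVec_mulVec, pow_mul_U, ← mulVec_mulVec, mul_comm]

lemma range_U_eq_maxGenEigenspace (κ : Fin D.m) :
    LinearMap.range (D.U κ).mulVecLin =
      Module.End.maxGenEigenspace (toLin' (adj A)) (D.μ κ) := by
  have hle : LinearMap.range (D.U κ).mulVecLin ≤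
      Module.End.maxGenEigenspace (toLin' (adj A)) (D.μ κ) := by
    rw [D.U_range]
    intro v hv
    have hsub : toLin' (adj A) - D.μ κ • 1 =
        toLin' (adj A - D.μ κ • (1 : Matrix (Fin n) (Fin n) ℂ)) := by
      rw [map_sub, map_smul, toLin'_one]
      rfl
    refine Module.End.mem_maxGenEigenspace _ _ _ |>.2 ⟨algMult A (D.μ κ), ?_⟩
    rw [hsub, ← toLin'_pow]
    exact hv
  refine Submodule.eq_of_le_of_finrank_eq hle ?_
  rw [LinearMap.finrank_maxGenEigenspace_eq, charpoly_toLin',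
    LinearMap.finrank_range_of_inj (D.U_mulVec_injective κ)]
  exact Module.finrank_fin_fun ℂ

lemma iSup_range_U_eq_top : ⨆ κ, LinearMap.range (D.U κ).mulVecLin = ⊤ := by
  rw [eq_top_iff, ← Module.End.iSup_maxGenEigenspace_eq_top (toLin' (adj A))]
  refine iSup_le fun z => ?_
  by_cases hz : Module.End.HasEigenvalue (toLin' (adj A)) z
  · obtain ⟨κ, rfl⟩ := (D.μ_range z).2 hz
    rw [← range_U_eq_maxGenEigenspace]
    exact le_iSup (fun κ => LinearMap.range (D.U κ).mulVecLin) κ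
  · have hbot : Module.End.maxGenEigenspace (toLin' (adj A)) z = ⊥ := by
      by_contra hne
      exact hz (Module.End.HasUnifEigenvalue.lt one_pos hne)
    exact hbot ▸ bot_le

lemma exists_eq_sum_U_mulVec (v : Fin n → ℂ) :
    ∃ ζ : ∀ κ, Fin (D.mult κ) → ℂ, v = ∑ κ, D.U κ *ᵥ ζ κ := by
  have hv : v ∈ ⨆ κ ∈ Finset.univ, LinearMap.range (D.U κ).mulVecLin := by
    simp only [Finset.mem_univ, iSup_pos, iSup_range_U_eq_top, Submodule.mem_top]
  obtain ⟨w, rfl⟩ := (Submodule.mem_iSup_finset_iff_exists_sum _ _).1 hv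
  choose ζ hζ using fun κ => (w κ).2
  exact ⟨ζ, Finset.sum_congr rfl fun κ _ => (hζ κ).symm⟩

end SpectralData

/-! ### Outputs of the adjoint system -/

section Output

variable {q p n : ℕ} {A : Matrix (Fin n) (Fin n) ℝ} {B : Fin q → Fin p → Fin n → ℝ}

/-- The output `∑_i ⟨B_{iσ}, e^{tA*} η_i⟩` of the adjoint array `η̇_i = A* η_i`. By duality, the
states with nonnegative outputs form the dual cone of the reachable set. -/
def output (A : Matrix (Fin n) (Fin n) ℝ) (B : Fin q → Fin p → Fin n → ℝ)
    (η : Fin q → Fin n → ℝ) (σ : Fin p) (t : ℝ) : ℝ :=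
  ∑ i, B i σ ⬝ᵥ (NormedSpace.exp (t • Aᵀ) *ᵥ η i)

/-- The output of the adjoint array at a complex state; it makes the complex generalized
eigenvectors of `A*` available as initial states. -/
def complexOutput (A : Matrix (Fin n) (Fin n) ℝ) (B : Fin q → Fin p → Fin n → ℝ)
    (η : Fin q → Fin n → ℂ) (σ : Fin p) (t : ℝ) : ℂ :=
  ∑ i, (fun a => (B i σ a : ℂ)) ⬝ᵥ (NormedSpace.exp (t • adj A) *ᵥ η i)

lemma adj_eq_map_transpose (A : Matrix (Fin n) (Fin n) ℝ) : adj A = Aᵀ.map Complex.ofReal := by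
  ext a b
  simp only [adj, conjTranspose_apply, map_apply, transpose_apply, RCLike.star_def,
    Complex.conj_ofReal]

lemma exp_smul_adj (A : Matrix (Fin n) (Fin n) ℝ) (t : ℝ) :
    NormedSpace.exp (t • adj A) = (NormedSpace.exp (t • Aᵀ)).map Complex.ofReal := by
  rw [← exp_map_ofReal, adj_eq_map_transpose]
  congr 1
  ext a b
  exact (Complex.ofReal_mul t (A b a)).symm

lemma re_map_ofReal_mulVec {m m' : Type*} [Fintype m] (M : Matrix m' m ℝ) (z : m → ℂ) (i : m') :
    ((M.map Complex.ofReal *ᵥ z) i).re = (M *ᵥ fun j => (z j).re) i := by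
  simp only [mulVec, dotProduct, map_apply, Complex.re_sum, Complex.re_ofReal_mul]

lemma re_complexOutput (η : Fin q → Fin n → ℂ) (σ : Fin p) (t : ℝ) :
    (complexOutput A B η σ t).re = output A B (fun i a => (η i a).re) σ t := by
  simp only [complexOutput, output, exp_smul_adj, Complex.re_sum, dotProduct,
    Complex.re_ofReal_mul, re_map_ofReal_mulVec]

lemma complexOutput_ofReal (η : Fin q → Fin n → ℝ) (σ : Fin p) (t : ℝ) :
    complexOutput A B (fun i a => (η i a : ℂ)) σ t = (output A B η σ t : ℂ) := by
  simp only [complexOutput, output, exp_smul_adj, dotProduct, Complex.ofReal_sum,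
    Complex.ofReal_mul, mulVec, map_apply]

lemma output_add (η θ : Fin q → Fin n → ℝ) (σ : Fin p) (t : ℝ) :
    output A B (η + θ) σ t = output A B η σ t + output A B θ σ t := by
  simp only [output, Pi.add_apply, mulVec_add, dotProduct_add, Finset.sum_add_distrib]

lemma output_smul (c : ℝ) (η : Fin q → Fin n → ℝ) (σ : Fin p) (t : ℝ) :
    output A B (c • η) σ t = c * output A B η σ t := by
  simp only [output, Pi.smul_apply, mulVec_smul, dotProduct_smul, Finset.mul_sum, smul_eq_mul]

lemma output_sum {ι : Type*} (s : Finset ι) (η : ι → Fin q → Fin n → ℝ) (σ : Fin p) (t : ℝ) :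
    output A B (∑ ν ∈ s, η ν) σ t = ∑ ν ∈ s, output A B (η ν) σ t := by
  simp only [output, Finset.sum_apply, mulVec_sum, dotProduct_sum]
  exact Finset.sum_comm

lemma output_exp (η : Fin q → Fin n → ℝ) (σ : Fin p) (s t : ℝ) :
    output A B (fun i => NormedSpace.exp (s • Aᵀ) *ᵥ η i) σ t = output A B η σ (t + s) := by
  simp only [output, mulVec_mulVec, ← exp_add_smul]

namespace SpectralData

variable (D : SpectralData A)

/-- The coefficient of `(t^r / r!) e^{μ_κ t}` in the output at the complex state `(I ⊗ U_κ) ζ`. -/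
def coeff (B : Fin q → Fin p → Fin n → ℝ) (κ : Fin D.m) (ζ : Fin q → Fin (D.mult κ) → ℂ)
    (σ : Fin p) (r : ℕ) : ℂ :=
  ∑ i, star (D.Lam κ ^ r *ᵥ D.Bk B κ i σ) ⬝ᵥ ζ i

/-- The real part of the complex state `(I ⊗ U_κ) ζ`. -/
def realMode (κ : Fin D.m) (ζ : Fin q → Fin (D.mult κ) → ℂ) : Fin q → Fin n → ℝ :=
  fun i a => ((D.U κ *ᵥ ζ i) a).re

variable {D}

lemma coeff_eq_zero {κ : Fin D.m} (ζ : Fin q → Fin (D.mult κ) → ℂ) (σ : Fin p) {r : ℕ}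
    (hr : D.mult κ ≤ r) : D.coeff B κ ζ σ r = 0 := by
  simp only [coeff, D.Lam_pow_eq_zero κ hr, zero_mulVec, star_zero, zero_dotProduct,
    Finset.sum_const_zero]

lemma coeff_smul {κ : Fin D.m} (c : ℂ) (ζ : Fin q → Fin (D.mult κ) → ℂ) (σ : Fin p) (r : ℕ) :
    D.coeff B κ (c • ζ) σ r = c * D.coeff B κ ζ σ r := by
  simp only [coeff, Pi.smul_apply, dotProduct_smul, smul_eq_mul, Finset.mul_sum]

lemma conjTranspose_incQ_mulVec_apply {κ : Fin D.m} (ζ : Fin q × Fin (D.mult κ) → ℂ)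
    (j : D.index B κ × Fin (D.mult κ)) :
    ((D.incQ B κ)ᴴ *ᵥ ζ) j = D.coeff B κ (fun i a => ζ (i, a)) j.1 j.2 := by
  simp only [mulVec, dotProduct, Fintype.sum_prod_type]
  rfl

lemma coeff_eq_sum_dotProduct_mulVec (κ : Fin D.m) (ζ : Fin q → Fin (D.mult κ) → ℂ)
    (σ : Fin p) (r : ℕ) : D.coeff B κ ζ σ r =
      ∑ i, (fun a => (B i σ a : ℂ)) ⬝ᵥ (D.U κ *ᵥ ((D.Lam κ)ᴴ ^ r *ᵥ ζ i)) := by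
  refine Finset.sum_congr rfl fun i _ => ?_
  have hB : star (fun a => (B i σ a : ℂ)) = fun a => (B i σ a : ℂ) :=
    funext fun a => Complex.conj_ofReal _
  rw [star_mulVec, Bk, star_mulVec, ← dotProduct_mulVec, conjTranspose_conjTranspose,
    ← dotProduct_mulVec, conjTranspose_pow, hB]

lemma complexOutput_U_mulVec (κ : Fin D.m) (ζ : Fin q → Fin (D.mult κ) → ℂ) (σ : Fin p) (t : ℝ) :
    complexOutput A B (fun i => D.U κ *ᵥ ζ i) σ t = ∑ r ∈ Finset.range n,
      D.coeff B κ ζ σ r * ((t : ℂ) ^ r / r.factorial * Complex.exp (D.μ κ * t)) := by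
  simp only [complexOutput, exp_mulVec_U, dotProduct_sum, dotProduct_smul,
    coeff_eq_sum_dotProduct_mulVec, Finset.sum_mul, smul_eq_mul]
  rw [Finset.sum_comm]
  exact Finset.sum_congr rfl fun r _ => Finset.sum_congr rfl fun i _ => mul_comm _ _

lemma complexOutput_sum_U_mulVec (ζ : ∀ κ, Fin q → Fin (D.mult κ) → ℂ) (σ : Fin p) (t : ℝ) :
    complexOutput A B (fun i => ∑ κ, D.U κ *ᵥ ζ κ i) σ t =
      expPoly D.μ n (fun κ => D.coeff B κ (ζ κ) σ) t := by
  simp only [expPoly, ← complexOutput_U_mulVec, complexOutput, mulVec_sum, dotProduct_sum]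
  exact Finset.sum_comm

lemma output_realMode (κ : Fin D.m) (ζ : Fin q → Fin (D.mult κ) → ℂ) (σ : Fin p) (t : ℝ) :
    output A B (D.realMode κ ζ) σ t = (∑ r ∈ Finset.range n,
      D.coeff B κ ζ σ r * ((t : ℂ) ^ r / r.factorial * Complex.exp (D.μ κ * t))).re := by
  rw [← complexOutput_U_mulVec, re_complexOutput]
  rfl

/-! ### Real eigenvalues -/

lemma mulVec_im_eq_zero {m m' : Type*} [Fintype m] {M : Matrix m' m ℂ} {v : m → ℂ}
    (hM : ∀ i j, (M i j).im = 0) (hv : ∀ j, (v j).im = 0) (i : m') : ((M *ᵥ v) i).im = 0 := by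
  simp only [mulVec, dotProduct, Complex.im_sum, Complex.mul_im, hM, hv, mul_zero, zero_mul,
    add_zero, Finset.sum_const_zero]

lemma ofReal_re_μ {κ : Fin D.m} (hκ : (D.μ κ).im = 0) : ((D.μ κ).re : ℂ) = D.μ κ :=
  Complex.ext rfl hκ.symm

lemma Ared_conjTranspose_map_conj {κ : Fin D.m} (hκ : (D.μ κ).im = 0) :
    ((D.Ared κ)ᴴ).map (starRingEnd ℂ) = (D.Ared κ)ᴴ := by
  have hU : (D.U κ).map (starRingEnd ℂ) = D.U κ :=
    ext fun a b => Complex.conj_eq_iff_im.2 (D.U_real κ hκ a b)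
  have hA : (adj A).map (starRingEnd ℂ) = adj A := by
    rw [adj_eq_map_transpose]
    exact ext fun a b => Complex.conj_ofReal _
  have hconj := congrArg (fun X : Matrix _ _ ℂ => X.map (starRingEnd ℂ)) (D.Ared_spec κ)
  simp only [Matrix.map_mul, hU, hA] at hconj
  exact D.U_mul_injective κ (hconj.symm.trans (D.Ared_spec κ))

lemma Lam_eq_map_re {κ : Fin D.m} (hκ : (D.μ κ).im = 0) :
    D.Lam κ = ((D.Lam κ).map Complex.re).map Complex.ofReal := by
  ext a b
  have hA : (D.Ared κ a b).im = 0 := by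
    have hconj := congrFun (congrFun (D.Ared_conjTranspose_map_conj hκ) b) a
    simp only [conjTranspose_apply, map_apply, RCLike.star_def, Complex.conj_conj] at hconj
    exact Complex.conj_eq_iff_im.1 hconj.symm
  refine Complex.ext rfl ?_
  simp [Lam, hA, hκ, Matrix.one_apply, apply_ite]

lemma Lam_pow_eq_map_re {κ : Fin D.m} (hκ : (D.μ κ).im = 0) (r : ℕ) :
    D.Lam κ ^ r = (((D.Lam κ).map Complex.re) ^ r).map Complex.ofReal := by
  conv_lhs => rw [Lam_eq_map_re hκ]
  exact (map_pow Complex.ofRealHom.mapMatrix _ _).symm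

lemma map_re_Lam_pow_eq_zero {κ : Fin D.m} (hκ : (D.μ κ).im = 0) {r : ℕ} (hr : D.mult κ ≤ r) :
    ((D.Lam κ).map Complex.re) ^ r = 0 := by
  refine map_injective Complex.ofReal_injective ?_
  change (((D.Lam κ).map Complex.re) ^ r).map Complex.ofReal = Matrix.map 0 Complex.ofReal
  rw [← Lam_pow_eq_map_re hκ, D.Lam_pow_eq_zero κ hr, Matrix.map_zero _ Complex.ofReal_zero]

lemma LamB_eq_zero (κ : Fin D.m) (σ : Fin p) {r : ℕ} (hr : D.mult κ ≤ r) :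
    D.LamB B κ r σ = 0 := by
  ext ia
  rw [LamB, D.Lam_pow_eq_zero κ hr, zero_mulVec, Pi.zero_apply, Complex.zero_re, Pi.zero_apply]

lemma LamB_block {κ : Fin D.m} (hκ : (D.μ κ).im = 0) (r : ℕ) (i : Fin q) (σ : Fin p) :
    (fun a => D.LamB B κ r σ (i, a)) =
      ((D.Lam κ).map Complex.re) ^ r *ᵥ fun a => (D.Bk B κ i σ a).re := by
  ext a
  rw [LamB, Lam_pow_eq_map_re hκ, re_map_ofReal_mulVec]

lemma Lam_pow_mulVec_Bk {κ : Fin D.m} (hκ : (D.μ κ).im = 0) (r : ℕ) (i : Fin q) (σ : Fin p)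
    (a : Fin (D.mult κ)) :
    (D.Lam κ ^ r *ᵥ D.Bk B κ i σ) a = (D.LamB B κ r σ (i, a) : ℂ) := by
  refine Complex.ext rfl (mulVec_im_eq_zero (fun a b => ?_) (mulVec_im_eq_zero (fun a b => ?_)
    fun a => Complex.ofReal_im _) a)
  · rw [Lam_pow_eq_map_re hκ, map_apply, Complex.ofReal_im]
  · rw [conjTranspose_apply, RCLike.star_def, Complex.conj_im, D.U_real κ hκ, neg_zero]

lemma coeff_eq_sum_LamB {κ : Fin D.m} (hκ : (D.μ κ).im = 0) (ζ : Fin q → Fin (D.mult κ) → ℂ)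
    (σ : Fin p) (r : ℕ) :
    D.coeff B κ ζ σ r = ∑ ia : Fin q × Fin (D.mult κ), (D.LamB B κ r σ ia : ℂ) * ζ ia.1 ia.2 := by
  rw [coeff, Fintype.sum_prod_type]
  refine Finset.sum_congr rfl fun i _ => Finset.sum_congr rfl fun a _ => ?_
  rw [Pi.star_apply, Lam_pow_mulVec_Bk hκ, RCLike.star_def, Complex.conj_ofReal]

lemma re_coeff {κ : Fin D.m} (hκ : (D.μ κ).im = 0) (ζ : Fin q → Fin (D.mult κ) → ℂ)
    (σ : Fin p) (r : ℕ) :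
    (D.coeff B κ ζ σ r).re = D.LamB B κ r σ ⬝ᵥ fun ia => (ζ ia.1 ia.2).re := by
  simp only [coeff_eq_sum_LamB hκ, dotProduct, Complex.re_sum, Complex.re_ofReal_mul]

lemma coeff_ofReal {κ : Fin D.m} (hκ : (D.μ κ).im = 0) (v : Fin q × Fin (D.mult κ) → ℝ)
    (σ : Fin p) (r : ℕ) :
    D.coeff B κ (fun i a => (v (i, a) : ℂ)) σ r = (D.LamB B κ r σ ⬝ᵥ v : ℝ) := by
  simp only [coeff_eq_sum_LamB hκ, dotProduct, Complex.ofReal_sum, Complex.ofReal_mul]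

lemma output_realMode_ofReal {κ : Fin D.m} (hκ : (D.μ κ).im = 0)
    (v : Fin q × Fin (D.mult κ) → ℝ) (σ : Fin p) (t : ℝ) :
    output A B (D.realMode κ fun i a => (v (i, a) : ℂ)) σ t =
      Real.exp ((D.μ κ).re * t) * ∑ r ∈ Finset.range n,
        t ^ r / r.factorial * (D.LamB B κ r σ ⬝ᵥ v) := by
  rw [output_realMode, Complex.re_sum, Finset.mul_sum]
  refine Finset.sum_congr rfl fun r _ => ?_
  rw [coeff_ofReal hκ, ← ofReal_re_μ hκ]
  norm_cast
  ring

lemma realMode_injective_block {κ : Fin D.m} (hκ : (D.μ κ).im = 0)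
    {v : Fin q × Fin (D.mult κ) → ℝ} {k l : Fin q}
    (h : D.realMode κ (fun i a => (v (i, a) : ℂ)) k = D.realMode κ (fun i a => (v (i, a) : ℂ)) l)
    (a : Fin (D.mult κ)) : v (k, a) = v (l, a) := by
  have hU : (fun a => (v (k, a) : ℂ)) = fun a => (v (l, a) : ℂ) := by
    refine D.U_mulVec_injective κ (funext fun a => Complex.ext (congrFun h a) ?_)
    rw [mulVec_im_eq_zero (D.U_real κ hκ) (fun _ => Complex.ofReal_im _),
      mulVec_im_eq_zero (D.U_real κ hκ) (fun _ => Complex.ofReal_im _)]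
  exact Complex.ofReal_injective (congrFun hU a)

lemma realMode_eq_of_re_eq {κ : Fin D.m} (hκ : (D.μ κ).im = 0)
    {ζ : Fin q → Fin (D.mult κ) → ℂ} {k l : Fin q} (h : ∀ a, (ζ k a).re = (ζ l a).re) :
    D.realMode κ ζ k = D.realMode κ ζ l := by
  have hU : D.U κ = ((D.U κ).map Complex.re).map Complex.ofReal :=
    ext fun a b => Complex.ext rfl (D.U_real κ hκ a b)
  ext a
  rw [realMode, realMode, hU, re_map_ofReal_mulVec, re_map_ofReal_mulVec, funext h]

end SpectralData

end Output

/-! ### Sufficiency of the connectivity conditions -/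

namespace SpectralData

section Sufficiency

variable {q p n : ℕ} {A : Matrix (Fin n) (Fin n) ℝ} {B : Fin q → Fin p → Fin n → ℝ}
  {D : SpectralData A} {k l : Fin q}

lemma forall_col_dotProduct_nonneg_iff {κ : Fin D.m} {I : Finset (Fin p)}
    {v : Fin q × Fin (D.mult κ) → ℝ} :
    (∀ j, 0 ≤ ((inc (D.Q B κ) I).map Complex.re).col j ⬝ᵥ v) ↔
      ∀ σ ∈ I, ∀ r, 0 ≤ D.LamB B κ r σ ⬝ᵥ v := by
  refine ⟨fun h σ hσ r => ?_, fun h j => h j.1 j.1.2 j.2⟩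
  rcases lt_or_ge r (D.mult κ) with hr | hr
  · exact h (⟨σ, hσ⟩, ⟨r, hr⟩)
  · rw [LamB_eq_zero κ σ hr, zero_dotProduct]

lemma dotProduct_eq_zero_of_mem_lineality {κ : Fin D.m} {I : Finset (Fin p)}
    {v w : Fin q × Fin (D.mult κ) → ℝ} (hw : w ∈ D.lineality B κ I)
    (hv : ∀ σ ∈ I, ∀ r, 0 ≤ D.LamB B κ r σ ⬝ᵥ v) : w ⬝ᵥ v = 0 :=
  mem_linealitySpace_iff.1 hw v (forall_col_dotProduct_nonneg_iff.2 hv)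

lemma antitone_indexSeq : Antitone (D.indexSeq B) := by
  refine antitone_nat_of_succ_le fun j => ?_
  rw [indexSeq]
  split_ifs
  · exact Finset.sdiff_subset
  · exact le_rfl

lemma indexSeq_succ (κ : Fin D.m) :
    D.indexSeq B (κ + 1) = D.index B κ \ D.removed B κ (D.index B κ) := by
  rw [indexSeq, dif_pos κ.2]
  rfl

lemma indexSeq_succ_subset_index (κ : Fin D.m) : D.indexSeq B (κ + 1) ⊆ D.index B κ :=
  antitone_indexSeq (Nat.le_succ κ)

lemma index_subset_indexSeq_succ {ν κ : Fin D.m} (h : ν < κ) :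
    D.index B κ ⊆ D.indexSeq B (ν + 1) :=
  antitone_indexSeq (Nat.succ_le_of_lt h)

lemma LamB_mem_lineality {κ : Fin D.m} (hκ : (D.μ κ).im = 0) {σ : Fin p}
    (hσ : σ ∈ D.indexSeq B (κ + 1)) (r : ℕ) : D.LamB B κ r σ ∈ D.lineality B κ (D.index B κ) := by
  classical
  rcases lt_or_ge r (D.mult κ) with hr | hr
  · rw [indexSeq_succ, Finset.mem_sdiff, removed, if_pos hκ, Finset.mem_filter] at hσ
    by_contra hnot
    exact hσ.2 ⟨hσ.1, ⟨r, hr⟩, hnot⟩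
  · rw [LamB_eq_zero κ σ hr]
    exact Submodule.zero_mem _

/-- The action of `I_q ⊗ e^{tΛ_κ*}`. A time shift of a mode with real eigenvalue `μ_κ` acts in
this way on its coordinates, up to the positive factor `e^{tμ_κ}`. -/
def shift (D : SpectralData A) (κ : Fin D.m) (t : ℝ) (v : Fin q × Fin (D.mult κ) → ℝ) :
    Fin q × Fin (D.mult κ) → ℝ :=
  fun ia => (NormedSpace.exp (t • ((D.Lam κ).map Complex.re)ᵀ) *ᵥ fun a => v (ia.1, a)) ia.2

lemma LamB_dotProduct_shift {κ : Fin D.m} (hκ : (D.μ κ).im = 0) (t : ℝ)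
    (v : Fin q × Fin (D.mult κ) → ℝ) (σ : Fin p) (r : ℕ) :
    D.LamB B κ r σ ⬝ᵥ D.shift κ t v =
      ∑ s ∈ Finset.range n, t ^ s / s.factorial * (D.LamB B κ (r + s) σ ⬝ᵥ v) := by
  have hblock := fun i => pow_mulVec_dotProduct_exp_mulVec ((D.Lam κ).map Complex.re)
    (fun r hr => map_re_Lam_pow_eq_zero hκ ((D.mult_le κ).trans hr))
    (fun a => (D.Bk B κ i σ a).re) (fun a => v (i, a)) t r
  simp only [← LamB_block hκ] at hblock
  simp only [dotProduct, Fintype.sum_prod_type, Finset.mul_sum] at hblock ⊢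
  exact (Finset.sum_congr rfl fun i _ => hblock i).trans Finset.sum_comm

lemma shift_neg_shift (κ : Fin D.m) (t : ℝ) (v : Fin q × Fin (D.mult κ) → ℝ) :
    D.shift κ (-t) (D.shift κ t v) = v := by
  ext ⟨i, a⟩
  change (NormedSpace.exp (-t • _) *ᵥ (NormedSpace.exp (t • _) *ᵥ fun a => v (i, a))) a = _
  rw [mulVec_mulVec, exp_neg_smul_mul_exp_smul, one_mulVec]

lemma coeffAt_re_μ {κ : Fin D.m} (hκ : (D.μ κ).im = 0) (a : Fin D.m → ℕ → ℂ) (r : ℕ) :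
    coeffAt D.μ a (D.μ κ).re r = a κ r := by
  rw [ofReal_re_μ hκ, coeffAt_apply_of_injective D.μ_injective]

section Elimination

open scoped ComplexOrder

variable {ζ : ∀ κ, Fin q → Fin (D.mult κ) → ℂ} {κ : Fin D.m}

lemma coeff_eq_zero_of_re_lt {σ : Fin p}
    (hprev : ∀ ν < κ, ∀ r, D.coeff B ν (ζ ν) σ r = 0) (ν : Fin D.m)
    (hν : (D.μ κ).re < (D.μ ν).re) (r : ℕ) : D.coeff B ν (ζ ν) σ r = 0 :=
  hprev ν (not_le.1 fun hle => hν.not_ge (D.μ_antitone κ ν hle)) r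

lemma coeffAt_re_eq_zero {σ : Fin p} (hκ : (D.μ κ).im ≠ 0)
    (hprev : ∀ ν < κ, ∀ r, D.coeff B ν (ζ ν) σ r = 0) (r : ℕ) :
    coeffAt D.μ (fun ν => D.coeff B ν (ζ ν) σ) (D.μ κ).re r = 0 := by
  refine Finset.sum_eq_zero fun ν _ => ite_eq_right_iff.2 fun hν => ?_
  refine hprev ν (D.μ_real_first κ ν ?_ hν.symm) r
  rintro rfl
  exact hκ (by rw [hν, Complex.ofReal_im])

lemma coeff_eq_zero_of_im_ne_zero {σ : Fin p} (hκ : (D.μ κ).im ≠ 0)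
    (hprev : ∀ ν < κ, ∀ r, D.coeff B ν (ζ ν) σ r = 0)
    (hf : ∀ t, 0 ≤ t → 0 ≤ expPoly D.μ n (fun ν => D.coeff B ν (ζ ν) σ) t) (r : ℕ) :
    D.coeff B κ (ζ κ) σ r = 0 :=
  coeff_eq_zero_of_nonneg D.μ_injective
    (fun ν _ hr => coeff_eq_zero (ζ ν) σ ((D.mult_le ν).trans hr)) hf
    (coeff_eq_zero_of_re_lt hprev)
    (fun r _ => by rw [coeffAt_re_eq_zero hκ hprev, Complex.zero_re]) κ rfl r r.zero_le

-- A polynomial with nonnegative leading coefficient is nonnegative for large times, and the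
-- pairings of the shifted vector are such polynomials in the time.
lemma exists_forall_LamB_dotProduct_shift_nonneg (hκ : (D.μ κ).im = 0)
    (hprev : ∀ σ ∈ D.index B κ, ∀ ν < κ, ∀ r, D.coeff B ν (ζ ν) σ r = 0)
    (hf : ∀ σ t, 0 ≤ t → 0 ≤ expPoly D.μ n (fun ν => D.coeff B ν (ζ ν) σ) t) :
    ∃ t, ∀ σ ∈ D.index B κ, ∀ r,
      0 ≤ D.LamB B κ r σ ⬝ᵥ D.shift κ t fun ia => (ζ κ ia.1 ia.2).re := by
  have hlead : ∀ σ ∈ D.index B κ, ∀ d, (∀ r, d < r → (D.coeff B κ (ζ κ) σ r).re = 0) →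
      0 ≤ (D.coeff B κ (ζ κ) σ d).re := fun σ hσ d hd => by
    simpa only [coeffAt_re_μ hκ] using coeffAt_nonneg_of_nonneg D.μ_injective
      (fun ν _ hr => coeff_eq_zero (ζ ν) σ ((D.mult_le ν).trans hr)) (hf σ)
      (coeff_eq_zero_of_re_lt (hprev σ hσ)) (by simpa only [coeffAt_re_μ hκ] using hd)
  have hev : ∀ᶠ t : ℝ in atTop, ∀ j, 0 ≤ ((inc (D.Q B κ) (D.index B κ)).map Complex.re).col j ⬝ᵥ
      D.shift κ t fun ia => (ζ κ ia.1 ia.2).re := by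
    refine eventually_all.2 fun j => ?_
    change ∀ᶠ t : ℝ in atTop, 0 ≤ D.LamB B κ j.2 j.1 ⬝ᵥ _
    simp only [LamB_dotProduct_shift hκ, ← re_coeff hκ]
    refine eventually_sum_pow_nonneg (fun s hs => ?_) fun d hd => hlead j.1 j.1.2 _ fun r hr => ?_
    · rw [coeff_eq_zero _ _ ((D.mult_le κ).trans (hs.trans (Nat.le_add_left _ _))),
        Complex.zero_re]
    · obtain ⟨s, rfl⟩ := Nat.exists_eq_add_of_le ((Nat.le_add_right _ d).trans hr.le)
      exact hd s (Nat.lt_of_add_lt_add_left hr)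
  obtain ⟨t, ht⟩ := hev.exists
  exact ⟨t, forall_col_dotProduct_nonneg_iff.1 ht⟩

lemma coeff_eq_zero_of_im_eq_zero (hκ : (D.μ κ).im = 0)
    (hprev : ∀ σ ∈ D.index B κ, ∀ ν < κ, ∀ r, D.coeff B ν (ζ ν) σ r = 0)
    (hf : ∀ σ t, 0 ≤ t → 0 ≤ expPoly D.μ n (fun ν => D.coeff B ν (ζ ν) σ) t) {σ : Fin p}
    (hσ : σ ∈ D.indexSeq B (κ + 1)) (r : ℕ) : D.coeff B κ (ζ κ) σ r = 0 := by
  obtain ⟨t, ht⟩ := exists_forall_LamB_dotProduct_shift_nonneg hκ hprev hf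
  have hzero : ∀ r, (D.coeff B κ (ζ κ) σ r).re = 0 := fun r => by
    rw [re_coeff hκ, ← shift_neg_shift κ t fun ia => (ζ κ ia.1 ia.2).re, LamB_dotProduct_shift hκ]
    refine Finset.sum_eq_zero fun s _ => ?_
    rw [dotProduct_eq_zero_of_mem_lineality (LamB_mem_lineality hκ hσ _) ht, mul_zero]
  exact coeff_eq_zero_of_nonneg D.μ_injective
    (fun ν _ hr => coeff_eq_zero (ζ ν) σ ((D.mult_le ν).trans hr)) (hf σ)
    (coeff_eq_zero_of_re_lt (hprev σ (indexSeq_succ_subset_index κ hσ)))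
    (fun r _ => by rw [coeffAt_re_μ hκ, hzero]) κ rfl r r.zero_le

lemma coeff_eq_zero_of_expPoly_nonneg
    (hf : ∀ σ t, 0 ≤ t → 0 ≤ expPoly D.μ n (fun ν => D.coeff B ν (ζ ν) σ) t) {σ : Fin p}
    (hσ : σ ∈ D.indexSeq B (κ + 1)) (r : ℕ) : D.coeff B κ (ζ κ) σ r = 0 := by
  induction κ using WellFoundedLT.induction generalizing σ r with
  | ind κ ih =>
    have hprev : ∀ σ ∈ D.index B κ, ∀ ν < κ, ∀ r, D.coeff B ν (ζ ν) σ r = 0 :=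
      fun σ hσ ν hν r => ih ν hν (index_subset_indexSeq_succ hν hσ) r
    by_cases hκ : (D.μ κ).im = 0
    · exact coeff_eq_zero_of_im_eq_zero hκ hprev hf hσ r
    · exact coeff_eq_zero_of_im_ne_zero hκ (hprev σ (indexSeq_succ_subset_index κ hσ)) (hf σ) r

lemma realMode_eq_of_stronglyPairConnected (hκ : (D.μ κ).im = 0)
    (hconn : StronglyPairConnected (D.incQ B κ) k l)
    (hf : ∀ σ t, 0 ≤ t → 0 ≤ expPoly D.μ n (fun ν => D.coeff B ν (ζ ν) σ) t) :
    D.realMode κ (ζ κ) k = D.realMode κ (ζ κ) l := by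
  obtain ⟨t, ht⟩ := exists_forall_LamB_dotProduct_shift_nonneg hκ (fun σ hσ ν hν r =>
    coeff_eq_zero_of_expPoly_nonneg hf (index_subset_indexSeq_succ hν hσ) r) hf
  have hshift := range_pairMatrix_subset_cone_iff.1 hconn.2 _
    (forall_col_dotProduct_nonneg_iff.2 ht)
  exact realMode_eq_of_re_eq hκ (congrFun (exp_smul_mulVec_injective _ t (funext hshift)))

lemma realMode_eq_of_pairConnected (hκ : (D.μ κ).im ≠ 0) (hconn : PairConnected (D.incQ B κ) k l)
    (hf : ∀ σ t, 0 ≤ t → 0 ≤ expPoly D.μ n (fun ν => D.coeff B ν (ζ ν) σ) t) :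
    D.realMode κ (ζ κ) k = D.realMode κ (ζ κ) l := by
  have hker : (D.incQ B κ)ᴴ *ᵥ (fun ia => ζ κ ia.1 ia.2) = 0 := by
    ext j
    rw [conjTranspose_incQ_mulVec_apply]
    exact coeff_eq_zero_of_im_ne_zero hκ (fun ν hν r =>
      coeff_eq_zero_of_expPoly_nonneg hf (index_subset_indexSeq_succ hν j.1.2) r) (hf j.1) j.2
  have hζ : ζ κ k = ζ κ l := funext (pairConnected_iff.1 hconn _ hker)
  ext a
  rw [realMode, realMode, hζ]

end Elimination

open scoped ComplexOrder in
theorem eq_of_output_nonneg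
    (ha : ∀ κ, (D.μ κ).im = 0 → StronglyPairConnected (D.incQ B κ) k l)
    (hb : ∀ κ, (D.μ κ).im ≠ 0 → PairConnected (D.incQ B κ) k l) {η : Fin q → Fin n → ℝ}
    (hη : ∀ σ t, 0 ≤ t → 0 ≤ output A B η σ t) : η k = η l := by
  choose ζ hζ using fun i => D.exists_eq_sum_U_mulVec fun a => (η i a : ℂ)
  have hf : ∀ σ t, 0 ≤ t → 0 ≤ expPoly D.μ n (fun ν => D.coeff B ν (fun i => ζ i ν) σ) t := by
    intro σ t ht
    rw [← complexOutput_sum_U_mulVec, ← funext hζ, complexOutput_ofReal]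
    exact Complex.zero_le_real.2 (hη σ t ht)
  have hmode : ∀ κ, D.realMode κ (fun i => ζ i κ) k = D.realMode κ (fun i => ζ i κ) l := fun κ =>
    (eq_or_ne (D.μ κ).im 0).elim
      (fun hκ => realMode_eq_of_stronglyPairConnected (ζ := fun κ i => ζ i κ) hκ (ha κ hκ) hf)
      (fun hκ => realMode_eq_of_pairConnected (ζ := fun κ i => ζ i κ) hκ (hb κ hκ) hf)
  have hsum : ∀ i, η i = ∑ κ, D.realMode κ (fun i => ζ i κ) i := fun i => by
    ext a
    simpa only [realMode, Complex.ofReal_re, Finset.sum_apply, Complex.re_sum] using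
      congrArg Complex.re (congrFun (hζ i) a)
  rw [hsum, hsum, Finset.sum_congr rfl fun κ _ => hmode κ]

end Sufficiency

end SpectralData

/-! ### Necessity of the connectivity conditions -/

namespace SpectralData

open Asymptotics

section Necessity

lemma isLittleO_pow_mul_cexp (c z : ℂ) (r : ℕ) {α : ℝ} (hα : z.re < α) :
    (fun t : ℝ => c * ((t : ℂ) ^ r / r.factorial * Complex.exp (z * t))) =o[atTop]
      fun t => Real.exp (α * t) := by
  have hpow : (fun t : ℝ => c / r.factorial * (t : ℂ) ^ r) =o[atTop]
      fun t => Real.exp ((α - z.re) * t) := by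
    refine IsLittleO.const_mul_left (IsLittleO.of_norm_left ?_) _
    simpa only [norm_pow, Complex.norm_real] using
      (isLittleO_pow_exp_pos_mul_atTop r (sub_pos.2 hα)).norm_left
  have hexp : (fun t : ℝ => Complex.exp (z * t)) =O[atTop] fun t => Real.exp (z.re * t) :=
    isBigO_of_le _ fun t => by
      rw [Complex.norm_exp, Complex.re_mul_ofReal, Real.norm_of_nonneg (Real.exp_pos _).le]
  refine (hpow.mul_isBigO hexp).congr (fun t => by ring) fun t => ?_
  rw [← Real.exp_add, ← add_mul, sub_add_cancel]

lemma eventually_nonneg_add_mul {f g e : ℝ → ℝ} {c : ℝ} (hc : 0 < c) (he : ∀ t, 0 ≤ e t)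
    (hf : ∀ᶠ t in atTop, c * e t ≤ f t) (hg : g =O[atTop] e) :
    ∀ᶠ ε in 𝓝 (0 : ℝ), ∀ᶠ t in atTop, 0 ≤ f t + ε * g t := by
  obtain ⟨C, hC⟩ := hg.bound
  have hsmall : ∀ᶠ ε : ℝ in 𝓝 0, |ε| * C ≤ c :=
    ((continuous_abs.mul continuous_const).tendsto' (0 : ℝ) 0
      (by simp)).eventually_le_const hc
  filter_upwards [hsmall] with ε hε
  filter_upwards [hf, hC] with t hft hgt
  rw [Real.norm_eq_abs, Real.norm_of_nonneg (he t)] at hgt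
  have habs : |ε * g t| ≤ f t := calc
    |ε * g t| = |ε| * |g t| := abs_mul _ _
    _ ≤ |ε| * (C * e t) := by gcongr
    _ = |ε| * C * e t := by ring
    _ ≤ c * e t := by gcongr; exact he t
    _ ≤ f t := hft
  linarith [neg_abs_le (ε * g t)]

variable {q p n : ℕ} {A : Matrix (Fin n) (Fin n) ℝ} {B : Fin q → Fin p → Fin n → ℝ}
  {D : SpectralData A} {k l : Fin q}

lemma exists_LamB_notMem_lineality {j : ℕ} {σ : Fin p} (hσ : σ ∉ D.indexSeq B j) :
    ∃ ν : Fin D.m, (ν : ℕ) < j ∧ (D.μ ν).im = 0 ∧ σ ∈ D.index B ν ∧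
      ∃ r : Fin (D.mult ν), D.LamB B ν r σ ∉ D.lineality B ν (D.index B ν) := by
  classical
  induction j with
  | zero => exact absurd (Finset.mem_univ σ) hσ
  | succ j ih =>
    by_cases h : σ ∈ D.indexSeq B j
    · rw [indexSeq] at hσ
      split_ifs at hσ with hj
      · have hrem : σ ∈ D.removed B ⟨j, hj⟩ (D.indexSeq B j) := by
          by_contra hnot
          exact hσ (Finset.mem_sdiff.2 ⟨h, hnot⟩)
        rw [removed] at hrem
        split_ifs at hrem with him
        · exact ⟨⟨j, hj⟩, Nat.lt_succ_self j, him, h, (Finset.mem_filter.1 hrem).2⟩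
        · exact absurd hrem (Finset.notMem_empty σ)
      · exact absurd h hσ
    · obtain ⟨ν, hν, hremoved⟩ := ih h
      exact ⟨ν, hν.trans (Nat.lt_succ_self j), hremoved⟩

lemma exists_forall_notMem_lineality_dotProduct_pos (κ : Fin D.m) (I : Finset (Fin p)) :
    ∃ v, (∀ σ ∈ I, ∀ r, 0 ≤ D.LamB B κ r σ ⬝ᵥ v) ∧ ∀ σ ∈ I, ∀ r : Fin (D.mult κ),
      D.LamB B κ r σ ∉ D.lineality B κ I → 0 < D.LamB B κ r σ ⬝ᵥ v := by
  obtain ⟨v, hv, hpos⟩ :=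
    exists_forall_notMem_linealitySpace_dotProduct_pos ((inc (D.Q B κ) I).map Complex.re)
  exact ⟨v, forall_col_dotProduct_nonneg_iff.1 hv, fun σ hσ r => hpos (⟨σ, hσ⟩, r)⟩

lemma output_realMode_eq_zero_of_mem_indexSeq_succ {κ : Fin D.m} (hκ : (D.μ κ).im = 0)
    {v : Fin q × Fin (D.mult κ) → ℝ} (hv : ∀ σ ∈ D.index B κ, ∀ r, 0 ≤ D.LamB B κ r σ ⬝ᵥ v)
    {σ : Fin p} (hσ : σ ∈ D.indexSeq B (κ + 1)) (t : ℝ) :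
    output A B (D.realMode κ fun i a => (v (i, a) : ℂ)) σ t = 0 := by
  rw [output_realMode_ofReal hκ, Finset.sum_eq_zero fun r _ => ?_, mul_zero]
  rw [dotProduct_eq_zero_of_mem_lineality (LamB_mem_lineality hκ hσ r) hv, mul_zero]

lemma output_realMode_nonneg {κ : Fin D.m} (hκ : (D.μ κ).im = 0)
    {v : Fin q × Fin (D.mult κ) → ℝ} {σ : Fin p} (hv : ∀ r, 0 ≤ D.LamB B κ r σ ⬝ᵥ v) {t : ℝ}
    (ht : 0 ≤ t) : 0 ≤ output A B (D.realMode κ fun i a => (v (i, a) : ℂ)) σ t := by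
  rw [output_realMode_ofReal hκ]
  exact mul_nonneg (Real.exp_pos _).le
    (Finset.sum_nonneg fun r _ => mul_nonneg (by positivity) (hv r))

lemma le_output_realMode {κ : Fin D.m} (hκ : (D.μ κ).im = 0) {v : Fin q × Fin (D.mult κ) → ℝ}
    {σ : Fin p} (hv : ∀ r, 0 ≤ D.LamB B κ r σ ⬝ᵥ v) (r : Fin (D.mult κ)) {t : ℝ} (ht : 1 ≤ t) :
    (D.LamB B κ r σ ⬝ᵥ v) / (r : ℕ).factorial * Real.exp ((D.μ κ).re * t) ≤
      output A B (D.realMode κ fun i a => (v (i, a) : ℂ)) σ t := by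
  rw [output_realMode_ofReal hκ, mul_comm]
  gcongr
  have hterm : ∀ s ∈ Finset.range n, 0 ≤ t ^ s / s.factorial * (D.LamB B κ s σ ⬝ᵥ v) :=
    fun s _ => mul_nonneg (by positivity) (hv s)
  refine le_trans ?_ (Finset.single_le_sum hterm (Finset.mem_range.2 (r.2.trans_le (D.mult_le κ))))
  rw [div_mul_eq_mul_div]
  gcongr
  exact le_mul_of_one_le_left (hv r) (one_le_pow₀ ht)

lemma isLittleO_output_realMode {κ : Fin D.m} (ζ : Fin q → Fin (D.mult κ) → ℂ) (σ : Fin p) {α : ℝ}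
    (hα : (D.μ κ).re < α) :
    output A B (D.realMode κ ζ) σ =o[atTop] fun t => Real.exp (α * t) := by
  rw [funext (output_realMode κ ζ σ)]
  have hsum := IsLittleO.fun_sum fun r (_ : r ∈ Finset.range n) =>
    isLittleO_pow_mul_cexp (D.coeff B κ ζ σ r) (D.μ κ) r hα
  exact (isBigO_of_le _ fun t => Complex.abs_re_le_norm _).trans_isLittleO hsum

lemma output_realMode_of_Lam_eq_zero {κ : Fin D.m} (hκ : D.Lam κ = 0)
    (ζ : Fin q → Fin (D.mult κ) → ℂ) (σ : Fin p) (t : ℝ) :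
    output A B (D.realMode κ ζ) σ t = (D.coeff B κ ζ σ 0 * Complex.exp (D.μ κ * t)).re := by
  rw [output_realMode, Finset.sum_eq_single 0 (fun r _ hr => ?_) fun h0 => ?_, pow_zero,
    Nat.factorial_zero, Nat.cast_one, div_one, one_mul]
  · simp only [coeff, hκ, zero_pow hr, zero_mulVec, star_zero, zero_dotProduct,
      Finset.sum_const_zero, zero_mul]
  · rw [coeff_eq_zero ζ σ ((D.mult_le κ).trans (not_lt.1 (mt Finset.mem_range.2 h0))), zero_mul]

lemma isBigO_output_realMode (h₁ : D.SemisimpleAssumption) {ν κ : Fin D.m} (hνκ : ν < κ)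
    (hν : (D.μ ν).im = 0) (ζ : Fin q → Fin (D.mult κ) → ℂ) (σ : Fin p) :
    output A B (D.realMode κ ζ) σ =O[atTop] fun t => Real.exp ((D.μ ν).re * t) := by
  rcases (D.μ_antitone ν κ hνκ.le).lt_or_eq with hlt | heq
  · exact (isLittleO_output_realMode ζ σ hlt).isBigO
  · have hκ : (D.μ κ).im ≠ 0 := fun hκ =>
      hνκ.ne (D.μ_injective (Complex.ext heq.symm (hν.trans hκ.symm)))
    have hLam : D.Lam κ = 0 := h₁ κ hκ ⟨ν, by rw [heq, ofReal_re_μ hν]⟩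
    refine IsBigO.of_bound ‖D.coeff B κ ζ σ 0‖ (Eventually.of_forall fun t => ?_)
    rw [output_realMode_of_Lam_eq_zero hLam, Real.norm_of_nonneg (Real.exp_pos _).le, ← heq,
      ← Complex.re_mul_ofReal, ← Complex.norm_exp, ← norm_mul]
    exact Complex.abs_re_le_norm _

/-- The state `∑_ν (I ⊗ U_ν) v_ν`, with `ν` running over the real eigenvalues that precede `μ_κ`. -/
def precedingState (D : SpectralData A) (κ : Fin D.m)
    (v : ∀ ν, Fin q × Fin (D.mult ν) → ℝ) : Fin q → Fin n → ℝ :=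
  ∑ ν with (D.μ ν).im = 0 ∧ ν < κ, D.realMode ν fun i a => (v ν (i, a) : ℂ)

lemma output_precedingState_eq_zero {κ : Fin D.m} {v : ∀ ν, Fin q × Fin (D.mult ν) → ℝ}
    (hv : ∀ ν, ∀ σ ∈ D.index B ν, ∀ r, 0 ≤ D.LamB B ν r σ ⬝ᵥ v ν) {σ : Fin p}
    (hσ : σ ∈ D.index B κ) (t : ℝ) : output A B (D.precedingState κ v) σ t = 0 := by
  rw [precedingState, output_sum]
  refine Finset.sum_eq_zero fun ν hν => ?_
  obtain ⟨-, him, hνκ⟩ := Finset.mem_filter.1 hν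
  exact output_realMode_eq_zero_of_mem_indexSeq_succ him (hv ν)
    (index_subset_indexSeq_succ hνκ hσ) t

-- The input `σ` is inactive in the modes before `ν`, and the modes after `ν` decay relative to it.
lemma eventually_le_output_precedingState {ν κ : Fin D.m} (hνκ : ν < κ) (hν : (D.μ ν).im = 0)
    {v : ∀ ν, Fin q × Fin (D.mult ν) → ℝ}
    (hv : ∀ ν, ∀ σ ∈ D.index B ν, ∀ r, 0 ≤ D.LamB B ν r σ ⬝ᵥ v ν) {σ : Fin p}
    (hσ : σ ∈ D.index B ν) {r : Fin (D.mult ν)} (hr : 0 < D.LamB B ν r σ ⬝ᵥ v ν) :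
    ∃ c > 0, ∀ᶠ t in atTop,
      c * Real.exp ((D.μ ν).re * t) ≤ output A B (D.precedingState κ v) σ t := by
  have hrest : (fun t => ∑ ν' ∈ ({ν' | (D.μ ν').im = 0 ∧ ν' < κ} : Finset (Fin D.m)).erase ν,
      output A B (D.realMode ν' fun i a => (v ν' (i, a) : ℂ)) σ t) =o[atTop]
        fun t => Real.exp ((D.μ ν).re * t) := by
    refine IsLittleO.fun_sum fun ν' hν' => ?_
    obtain ⟨hne, hmem⟩ := Finset.mem_erase.1 hν'
    have him := (Finset.mem_filter.1 hmem).2.1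
    rcases hne.lt_or_gt with hlt | hlt
    · refine (isLittleO_zero _ _).congr_left fun t => ?_
      exact (output_realMode_eq_zero_of_mem_indexSeq_succ him (hv ν')
        (index_subset_indexSeq_succ hlt hσ) t).symm
    · refine isLittleO_output_realMode _ σ ((D.μ_antitone ν ν' hlt.le).lt_of_ne fun heq => hne ?_)
      exact D.μ_injective (Complex.ext heq (him.trans hν.symm))
  set c := (D.LamB B ν r σ ⬝ᵥ v ν) / (r : ℕ).factorial
  have hc : 0 < c := div_pos hr (Nat.cast_pos.2 (Nat.factorial_pos _))
  refine ⟨c / 2, half_pos hc, ?_⟩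
  filter_upwards [hrest.def (half_pos hc), eventually_ge_atTop 1] with t hsmall ht
  rw [precedingState, output_sum, ← Finset.add_sum_erase _ _
    (Finset.mem_filter.2 ⟨Finset.mem_univ ν, hν, hνκ⟩)]
  rw [Real.norm_eq_abs, Real.norm_of_nonneg (Real.exp_pos _).le] at hsmall
  linarith [le_output_realMode hν (hv ν σ hσ) r ht, (abs_le.1 hsmall).1]

theorem exists_dominating_state (κ : Fin D.m) : ∃ θ : Fin q → Fin n → ℝ,
    (∀ σ ∈ D.index B κ, ∀ t, output A B θ σ t = 0) ∧
    ∀ σ ∉ D.index B κ, ∃ ν < κ, (D.μ ν).im = 0 ∧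
      ∃ c > 0, ∀ᶠ t in atTop, c * Real.exp ((D.μ ν).re * t) ≤ output A B θ σ t := by
  choose v hv hpos using fun ν : Fin D.m =>
    exists_forall_notMem_lineality_dotProduct_pos (B := B) ν (D.index B ν)
  refine ⟨D.precedingState κ v, fun σ hσ t => output_precedingState_eq_zero hv hσ t,
    fun σ hσ => ?_⟩
  obtain ⟨ν, hνκ, him, hσν, r, hr⟩ := exists_LamB_notMem_lineality hσ
  exact ⟨ν, hνκ, him, eventually_le_output_precedingState hνκ him hv hσν (hpos ν σ hσν r hr)⟩

lemma eq_of_eventually_output_nonneg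
    (hP : ∀ η : Fin q → Fin n → ℝ, (∀ σ t, 0 ≤ t → 0 ≤ output A B η σ t) → η k = η l)
    {η : Fin q → Fin n → ℝ} (hη : ∀ σ, ∀ᶠ t in atTop, 0 ≤ output A B η σ t) : η k = η l := by
  obtain ⟨T, hT⟩ := eventually_atTop.1 (eventually_all.2 hη)
  refine exp_smul_mulVec_injective Aᵀ T
    (hP (fun i => NormedSpace.exp (T • Aᵀ) *ᵥ η i) fun σ t ht => ?_)
  rw [output_exp]
  exact hT _ (le_add_of_nonneg_left ht) σ

-- The perturbations `θ + ε ψ` of a dominating state `θ` by a mode `ψ` have eventually nonnegative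
-- outputs for small `ε ≥ 0`; two values of `ε` isolate `ψ`.
theorem realMode_eq_of_output_nonneg (h₁ : D.SemisimpleAssumption)
    (hP : ∀ η : Fin q → Fin n → ℝ, (∀ σ t, 0 ≤ t → 0 ≤ output A B η σ t) → η k = η l)
    {κ : Fin D.m} {ζ : Fin q → Fin (D.mult κ) → ℂ}
    (hζ : ∀ σ ∈ D.index B κ, ∀ t, 0 ≤ t → 0 ≤ output A B (D.realMode κ ζ) σ t) :
    D.realMode κ ζ k = D.realMode κ ζ l := by
  obtain ⟨θ, hθ, hdom⟩ := exists_dominating_state (B := B) κ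
  have hev : ∀ᶠ ε in 𝓝[≥] (0 : ℝ), ∀ σ, ∀ᶠ t in atTop,
      0 ≤ output A B (θ + ε • D.realMode κ ζ) σ t := by
    simp only [output_add, output_smul]
    refine eventually_all.2 fun σ => ?_
    by_cases hσ : σ ∈ D.index B κ
    · filter_upwards [self_mem_nhdsWithin] with ε hε
      filter_upwards [eventually_ge_atTop 0] with t ht
      rw [hθ σ hσ, zero_add]
      exact mul_nonneg hε (hζ σ hσ t ht)
    · obtain ⟨ν, hνκ, him, c, hc, hlow⟩ := hdom σ hσ
      exact (eventually_nonneg_add_mul hc (fun t => (Real.exp_pos _).le) hlow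
        (isBigO_output_realMode h₁ hνκ him ζ σ)).filter_mono nhdsWithin_le_nhds
  have hzero : θ k = θ l := by
    simpa only [zero_smul, add_zero] using
      eq_of_eventually_output_nonneg hP (hev.self_of_nhdsWithin Set.self_mem_Ici)
  obtain ⟨ε, hε, hpos⟩ := ((hev.filter_mono (nhdsWithin_mono _ Set.Ioi_subset_Ici_self)).and
    self_mem_nhdsWithin).exists
  have hsum := eq_of_eventually_output_nonneg hP hε
  rw [Pi.add_apply, Pi.add_apply, hzero, Pi.smul_apply, Pi.smul_apply] at hsum
  exact smul_right_injective (Fin n → ℝ) (Set.mem_Ioi.1 hpos).ne' (add_left_cancel hsum)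

theorem stronglyPairConnected_of_output (h₁ : D.SemisimpleAssumption)
    (hP : ∀ η : Fin q → Fin n → ℝ, (∀ σ t, 0 ≤ t → 0 ≤ output A B η σ t) → η k = η l)
    {κ : Fin D.m} (hκ : (D.μ κ).im = 0) : StronglyPairConnected (D.incQ B κ) k l := by
  refine ⟨fun ia j => ?_, range_pairMatrix_subset_cone_iff.2 fun v hv => ?_⟩
  · change ((D.Lam κ ^ (j.2 : ℕ) *ᵥ D.Bk B κ ia.1 j.1) ia.2).im = 0
    rw [Lam_pow_mulVec_Bk hκ, Complex.ofReal_im]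
  · exact realMode_injective_block hκ (realMode_eq_of_output_nonneg h₁ hP fun σ hσ t ht =>
      output_realMode_nonneg hκ (forall_col_dotProduct_nonneg_iff.1 hv σ hσ) ht)

theorem pairConnected_of_output (h₁ : D.SemisimpleAssumption)
    (hP : ∀ η : Fin q → Fin n → ℝ, (∀ σ t, 0 ≤ t → 0 ≤ output A B η σ t) → η k = η l)
    (κ : Fin D.m) : PairConnected (D.incQ B κ) k l := by
  refine pairConnected_iff.2 fun z hz => ?_
  set ζ : Fin q → Fin (D.mult κ) → ℂ := fun i a => z (i, a)
  have hcoeff : ∀ σ ∈ D.index B κ, ∀ r, D.coeff B κ ζ σ r = 0 := fun σ hσ r => by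
    rcases lt_or_ge r (D.mult κ) with hr | hr
    · rw [← conjTranspose_incQ_mulVec_apply z (⟨σ, hσ⟩, ⟨r, hr⟩), hz, Pi.zero_apply]
    · exact coeff_eq_zero ζ σ hr
  have hmode : ∀ c : ℂ, D.realMode κ (c • ζ) k = D.realMode κ (c • ζ) l := fun c => by
    refine realMode_eq_of_output_nonneg h₁ hP fun σ hσ t _ => ?_
    rw [output_realMode, Finset.sum_eq_zero fun r _ => ?_, Complex.zero_re]
    rw [coeff_smul, hcoeff σ hσ, mul_zero, zero_mul]
  have hU : D.U κ *ᵥ ζ k = D.U κ *ᵥ ζ l := by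
    refine funext fun a => Complex.ext ?_ ?_
    · simpa only [realMode, one_smul] using congrFun (hmode 1) a
    · simpa only [realMode, Pi.smul_apply, mulVec_smul, smul_eq_mul, Complex.I_mul_re,
        neg_inj] using congrFun (hmode Complex.I) a
  exact congrFun (D.U_mulVec_injective κ hU)

end Necessity

end SpectralData

/-! ### Variation of constants -/

section VariationOfConstants

lemma intervalIntegrable_of_mem_Icc {E : Type*} [NormedAddCommGroup E] {f : ℝ → E} {s t : ℝ}
    (hf : IntervalIntegrable f volume 0 t) (hs : s ∈ Set.Icc 0 t) :
    IntervalIntegrable f volume 0 s :=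
  hf.mono_set (Set.uIcc_subset_uIcc_left (Set.Icc_subset_uIcc hs))

lemma integral_integral_swap_triangle {E : Type*} [NormedAddCommGroup E] [NormedSpace ℝ E]
    {f : ℝ → ℝ → E} {t : ℝ} (ht : 0 ≤ t)
    (hf : IntegrableOn f.uncurry (Set.Ioc 0 t ×ˢ Set.Ioc 0 t)) :
    ∫ r in (0 : ℝ)..t, ∫ s in (0 : ℝ)..r, f r s = ∫ s in (0 : ℝ)..t, ∫ r in s..t, f r s := by
  let F : ℝ → ℝ → E := fun r s => if s ≤ r then f r s else 0
  have hFrow : ∀ r, F r = (Set.Iic r).indicator (f r) := fun r => rfl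
  have hFcol : ∀ s, (F · s) = (Set.Ici s).indicator (f · s) := fun s => rfl
  have hF : IntegrableOn F.uncurry (Set.uIoc 0 t ×ˢ Set.uIoc 0 t) := by
    rw [Set.uIoc_of_le ht]
    exact hf.indicator (measurableSet_le measurable_snd measurable_fst)
  have hrow : ∀ r ∈ Set.uIcc 0 t, ∫ s in (0 : ℝ)..r, f r s = ∫ s in (0 : ℝ)..t, F r s := by
    intro r hr
    rw [Set.uIcc_of_le ht] at hr
    rw [hFrow, intervalIntegral.integral_of_le ht, setIntegral_indicator measurableSet_Iic,
      Set.Ioc_inter_Iic, min_eq_right hr.2, intervalIntegral.integral_of_le hr.1]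
  have hcol : ∀ s ∈ Set.uIoc 0 t, ∫ r in (0 : ℝ)..t, F r s = ∫ r in s..t, f r s := by
    intro s hs
    rw [Set.uIoc_of_le ht] at hs
    have hinter : Set.Ioc 0 t ∩ Set.Ici s = Set.Icc s t := Set.ext fun r =>
      ⟨fun h => ⟨h.2, h.1.2⟩, fun h => ⟨⟨hs.1.trans_le h.1, h.2⟩, h.1⟩⟩
    rw [hFcol, intervalIntegral.integral_of_le ht, setIntegral_indicator measurableSet_Ici, hinter,
      integral_Icc_eq_integral_Ioc, intervalIntegral.integral_of_le hs.2]
  rw [intervalIntegral.integral_congr hrow, intervalIntegral_intervalIntegral_swap hF]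
  exact intervalIntegral.integral_congr_ae (Eventually.of_forall hcol)

variable {m m' : Type*} [Fintype m] [Fintype m']

lemma intervalIntegrable_mulVec {M : ℝ → Matrix m' m ℝ} (hM : Continuous M) {b : ℝ → m → ℝ}
    {s t : ℝ} (hb : IntervalIntegrable b volume s t) :
    IntervalIntegrable (fun r => M r *ᵥ b r) volume s t := by
  rw [intervalIntegrable_iff] at hb
  refine intervalIntegrable_iff.2 (Integrable.of_eval fun a => integrable_finsetSum _ fun j _ => ?_)
  exact intervalIntegrable_iff.1 (IntervalIntegrable.continuousOn_mul
    (intervalIntegrable_iff.2 (hb.eval j)) (hM.matrix_elem a j).continuousOn)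

lemma mulVec_intervalIntegral (M : Matrix m' m ℝ) {b : ℝ → m → ℝ} {s t : ℝ}
    (hb : IntervalIntegrable b volume s t) :
    M *ᵥ (∫ r in s..t, b r) = ∫ r in s..t, M *ᵥ b r :=
  (M.mulVecLin.toContinuousLinearMap.intervalIntegral_comp_comm hb).symm

lemma integrableOn_mulVec_prod {K : ℝ → Matrix m' m ℝ} (hK : Continuous K) {c : ℝ → m → ℝ}
    {t : ℝ} (hc : IntegrableOn c (Set.Ioc 0 t)) :
    IntegrableOn (fun x : ℝ × ℝ => K x.1 *ᵥ c x.2) (Set.Ioc 0 t ×ˢ Set.Ioc 0 t) := by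
  rw [IntegrableOn, Measure.volume_eq_prod, ← Measure.prod_restrict]
  exact Integrable.of_eval fun a => integrable_finsetSum _ fun j _ =>
    Integrable.mul_prod (f := fun r => K r a j) (g := fun s => c s j)
      (hK.matrix_elem a j).integrableOn_Ioc (hc.eval j)

lemma integral_mulVec_primitive {K : ℝ → Matrix m' m ℝ} (hK : Continuous K) {c : ℝ → m → ℝ}
    {t : ℝ} (ht : 0 ≤ t) (hc : IntervalIntegrable c volume 0 t) :
    ∫ r in (0 : ℝ)..t, K r *ᵥ (∫ s in (0 : ℝ)..r, c s) =
      ∫ s in (0 : ℝ)..t, ∫ r in s..t, K r *ᵥ c s := by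
  rw [← integral_integral_swap_triangle (f := fun r s => K r *ᵥ c s) ht
    (integrableOn_mulVec_prod hK ((intervalIntegrable_iff_integrableOn_Ioc_of_le ht).1 hc))]
  refine intervalIntegral.integral_congr fun r hr => mulVec_intervalIntegral _ ?_
  exact intervalIntegrable_of_mem_Icc hc (Set.uIcc_of_le ht ▸ hr)

variable {A : Matrix m m ℝ} {b : ℝ → m → ℝ} {t τ : ℝ}

lemma intervalIntegrable_mulVec_of_continuousOn (A : Matrix m m ℝ) {y : ℝ → m → ℝ}
    (hy : ContinuousOn y (Set.Icc 0 τ)) (ht : t ∈ Set.Icc 0 τ) :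
    IntervalIntegrable (fun s => A *ᵥ y s) volume 0 t :=
  intervalIntegrable_mulVec continuous_const
    (hy.mono (Set.uIcc_of_le ht.1 ▸ Set.Icc_subset_Icc_right ht.2)).intervalIntegrable

lemma eq_zero_of_eq_integral_mulVec (hτ : 0 ≤ τ) {y : ℝ → m → ℝ}
    (hy : ContinuousOn y (Set.Icc 0 τ))
    (h : ∀ t ∈ Set.Icc 0 τ, y t = ∫ s in (0 : ℝ)..t, A *ᵥ y s) : ∀ t ∈ Set.Icc 0 τ, y t = 0 := by
  let y' : ℝ → m → ℝ := Set.IccExtend hτ fun t => y t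
  have hy' : ∀ t ∈ Set.Icc 0 τ, y' t = y t := fun t ht => Set.IccExtend_of_mem _ _ ht
  have hAy' : Continuous fun s => A *ᵥ y' s :=
    continuous_const.matrix_mulVec (continuousOn_iff_continuous_domRestrict.1 hy).Icc_extend'
  let g : ℝ → m → ℝ := fun t => ∫ s in (0 : ℝ)..t, A *ᵥ y' s
  have hg : ∀ t, HasDerivAt g (A *ᵥ y' t) t := fun t => hAy'.integral_hasStrictDerivAt 0 t
    |>.hasDerivAt
  have hgy : ∀ t ∈ Set.Icc 0 τ, g t = y t := fun t ht => by
    rw [h t ht]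
    refine intervalIntegral.integral_congr fun s hs => ?_
    rw [Set.uIcc_of_le ht.1] at hs
    simp only [hy' s ⟨hs.1, hs.2.trans ht.2⟩]
  have hLip : ∀ t ∈ Set.Ico 0 τ, LipschitzOnWith ‖A.mulVecLin.toContinuousLinearMap‖₊
      (fun x => A *ᵥ x) Set.univ := fun t _ =>
    A.mulVecLin.toContinuousLinearMap.lipschitz.lipschitzOnWith
  have huniq : Set.EqOn g (fun _ => 0) (Set.Icc 0 τ) :=
    ODE_solution_unique_of_mem_Icc_right (v := fun _ x => A *ᵥ x) (s := fun _ => Set.univ) hLip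
      (fun t _ => (hg t).continuousAt.continuousWithinAt)
      (fun t ht => by
        have ht' := Set.Ico_subset_Icc_self ht
        rw [hgy t ht', ← hy' t ht']
        exact (hg t).hasDerivWithinAt)
      (fun _ _ => Set.mem_univ _) continuousOn_const
      (fun t _ => by simpa only [mulVec_zero] using hasDerivWithinAt_const t (Set.Ici t) 0)
      (fun _ _ => Set.mem_univ _) intervalIntegral.integral_same
  exact fun t ht => (hgy t ht).symm.trans (huniq ht)

variable [DecidableEq m]

lemma continuous_exp_sub_smul (A : Matrix m m ℝ) (t : ℝ) :
    Continuous fun s : ℝ => NormedSpace.exp ((t - s) • A) :=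
  (continuous_exp_smul A).comp (continuous_const.sub continuous_id)

lemma continuous_exp_neg_smul (A : Matrix m m ℝ) :
    Continuous fun s : ℝ => NormedSpace.exp (-s • A) :=
  (continuous_exp_smul A).comp continuous_neg

lemma continuous_exp_smul_mulVec (A : Matrix m m ℝ) (v : m → ℝ) :
    Continuous fun t : ℝ => NormedSpace.exp (t • A) *ᵥ v :=
  (continuous_exp_smul A).matrix_mulVec continuous_const

open scoped Matrix.Norms.Operator in
lemma hasDerivAt_exp_smul_mulVec (A : Matrix m m ℝ) (v : m → ℝ) (t : ℝ) :
    HasDerivAt (fun r : ℝ => NormedSpace.exp (r • A) *ᵥ v)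
      (A *ᵥ (NormedSpace.exp (t • A) *ᵥ v)) t := by
  rw [mulVec_mulVec]
  exact ((mulVecBilin ℝ ℝ).flip v).toContinuousLinearMap.hasFDerivAt.comp_hasDerivAt t
    (hasDerivAt_exp_smul_const' (𝕂 := ℝ) A t)

lemma integral_mulVec_exp (A : Matrix m m ℝ) (v : m → ℝ) (s t : ℝ) :
    ∫ r in s..t, A *ᵥ (NormedSpace.exp (r • A) *ᵥ v) =
      NormedSpace.exp (t • A) *ᵥ v - NormedSpace.exp (s • A) *ᵥ v :=
  intervalIntegral.integral_eq_sub_of_hasDerivAt (fun r _ => hasDerivAt_exp_smul_mulVec A v r)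
    ((continuous_const.matrix_mulVec (continuous_exp_smul_mulVec A v)).intervalIntegrable _ _)

/-- The response `∫_0^t e^{A(t-s)} b(s) ds` at time `t`, starting from the origin, of the linear
system `ẋ = A x + b` to the forcing `b`. -/
def response (A : Matrix m m ℝ) (b : ℝ → m → ℝ) (t : ℝ) : m → ℝ :=
  ∫ s in (0 : ℝ)..t, NormedSpace.exp ((t - s) • A) *ᵥ b s

lemma response_zero_right (A : Matrix m m ℝ) (b : ℝ → m → ℝ) : response A b 0 = 0 :=
  intervalIntegral.integral_same

lemma response_eq_exp_mulVec (hb : IntervalIntegrable b volume 0 t) :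
    response A b t = NormedSpace.exp (t • A) *ᵥ
      ∫ s in (0 : ℝ)..t, NormedSpace.exp (-s • A) *ᵥ b s := by
  rw [mulVec_intervalIntegral _ (intervalIntegrable_mulVec (continuous_exp_neg_smul A) hb)]
  simp only [mulVec_mulVec, ← exp_add_smul, ← sub_eq_add_neg, response]

lemma continuousOn_response (hτ : 0 ≤ τ) (hb : IntervalIntegrable b volume 0 τ) :
    ContinuousOn (response A b) (Set.Icc 0 τ) := by
  have hprim := intervalIntegral.continuousOn_primitive_interval'
    (intervalIntegrable_mulVec (continuous_exp_neg_smul A) hb) Set.left_mem_uIcc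
  rw [Set.uIcc_of_le hτ] at hprim
  refine ContinuousOn.congr ?_ fun t ht =>
    response_eq_exp_mulVec (intervalIntegrable_of_mem_Icc hb ht)
  rw [continuousOn_iff_continuous_domRestrict] at hprim ⊢
  exact ((continuous_exp_smul A).comp continuous_subtype_val).matrix_mulVec hprim

lemma response_eq_integral (ht : 0 ≤ t) (hb : IntervalIntegrable b volume 0 t) :
    response A b t = ∫ s in (0 : ℝ)..t, (A *ᵥ response A b s + b s) := by
  have hinner : ∀ s, ∫ r in s..t, (A * NormedSpace.exp (r • A)) *ᵥ
      (NormedSpace.exp (-s • A) *ᵥ b s) = NormedSpace.exp ((t - s) • A) *ᵥ b s - b s := by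
    intro s
    simp only [← mulVec_mulVec]
    rw [integral_mulVec_exp, mulVec_mulVec, mulVec_mulVec, ← exp_add_smul, ← exp_add_smul,
      add_neg_cancel, zero_smul, NormedSpace.exp_zero, one_mulVec, ← sub_eq_add_neg]
  have hdrift : ∫ s in (0 : ℝ)..t, A *ᵥ response A b s = response A b t - ∫ s in (0 : ℝ)..t, b s :=
    calc ∫ s in (0 : ℝ)..t, A *ᵥ response A b s
        = ∫ r in (0 : ℝ)..t, (A * NormedSpace.exp (r • A)) *ᵥ
            ∫ s in (0 : ℝ)..r, NormedSpace.exp (-s • A) *ᵥ b s := by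
          refine intervalIntegral.integral_congr fun r hr => ?_
          have hbr := intervalIntegrable_of_mem_Icc hb (Set.uIcc_of_le ht ▸ hr)
          simp only [response_eq_exp_mulVec hbr, mulVec_mulVec]
      _ = ∫ s in (0 : ℝ)..t, (NormedSpace.exp ((t - s) • A) *ᵥ b s - b s) := by
          rw [integral_mulVec_primitive (continuous_const.matrix_mul (continuous_exp_smul A)) ht
            (intervalIntegrable_mulVec (continuous_exp_neg_smul A) hb)]
          simp only [hinner]
      _ = response A b t - ∫ s in (0 : ℝ)..t, b s :=
          intervalIntegral.integral_sub
            (intervalIntegrable_mulVec (continuous_exp_sub_smul A t) hb) hb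
  rw [intervalIntegral.integral_add (intervalIntegrable_mulVec_of_continuousOn A
    (continuousOn_response ht hb) (Set.right_mem_Icc.2 ht)) hb, hdrift, sub_add_cancel]

lemma exp_mulVec_add_response_eq_integral (ht : 0 ≤ t) (hb : IntervalIntegrable b volume 0 t)
    (v : m → ℝ) :
    NormedSpace.exp (t • A) *ᵥ v + response A b t =
      v + ∫ s in (0 : ℝ)..t, (A *ᵥ (NormedSpace.exp (s • A) *ᵥ v + response A b s) + b s) := by
  have hsplit : ∫ s in (0 : ℝ)..t,
      (A *ᵥ (NormedSpace.exp (s • A) *ᵥ v + response A b s) + b s) =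
      (∫ s in (0 : ℝ)..t, A *ᵥ (NormedSpace.exp (s • A) *ᵥ v)) +
        ∫ s in (0 : ℝ)..t, (A *ᵥ response A b s + b s) := by
    simp only [mulVec_add, add_assoc]
    exact intervalIntegral.integral_add
      ((continuous_const.matrix_mulVec (continuous_exp_smul_mulVec A v)).intervalIntegrable _ _)
      ((intervalIntegrable_mulVec_of_continuousOn A (continuousOn_response ht hb)
        (Set.right_mem_Icc.2 ht)).add hb)
  rw [hsplit, integral_mulVec_exp, ← response_eq_integral ht hb, zero_smul, NormedSpace.exp_zero,
    one_mulVec, ← add_assoc, add_sub_cancel]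

theorem eq_exp_mulVec_add_response (hτ : 0 ≤ τ) (hb : IntervalIntegrable b volume 0 τ)
    {x : ℝ → m → ℝ} (hx : ContinuousOn x (Set.Icc 0 τ))
    (h : ∀ t ∈ Set.Icc 0 τ, x t = x 0 + ∫ s in (0 : ℝ)..t, (A *ᵥ x s + b s)) :
    x τ = NormedSpace.exp (τ • A) *ᵥ x 0 + response A b τ := by
  let x' : ℝ → m → ℝ := fun t => NormedSpace.exp (t • A) *ᵥ x 0 + response A b t
  have hx' : ContinuousOn x' (Set.Icc 0 τ) :=
    (continuous_exp_smul_mulVec A _).continuousOn.add (continuousOn_response hτ hb)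
  have hdiff : ∀ t ∈ Set.Icc 0 τ, x t - x' t = ∫ s in (0 : ℝ)..t, A *ᵥ (x s - x' s) := by
    intro t ht
    have hbt := intervalIntegrable_of_mem_Icc hb ht
    rw [h t ht, show x' t = _ from exp_mulVec_add_response_eq_integral ht.1 hbt (x 0),
      add_sub_add_left_eq_sub, ← intervalIntegral.integral_sub
        ((intervalIntegrable_mulVec_of_continuousOn A hx ht).add hbt)
        ((intervalIntegrable_mulVec_of_continuousOn A hx' ht).add hbt)]
    simp only [add_sub_add_right_eq_sub, mulVec_sub, x']
  exact sub_eq_zero.1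
    (eq_zero_of_eq_integral_mulVec hτ (hx.sub hx') hdiff τ (Set.right_mem_Icc.2 hτ))

end VariationOfConstants

/-! ### Positively reachable states -/

section Reachability

/-- The signal that follows `f` up to time `s` and then `g`, started at time `s`. -/
def concatAt {E : Type*} (s : ℝ) (f g : ℝ → E) (r : ℝ) : E := if r ≤ s then f r else g (r - s)

lemma eqOn_concatAt_left {E : Type*} {s : ℝ} (hs : 0 ≤ s) (f g : ℝ → E) :
    Set.EqOn (concatAt s f g) f (Set.uIoc 0 s) := fun _ hr =>
  if_pos (Set.uIoc_of_le hs ▸ hr).2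

lemma eqOn_concatAt_right {E : Type*} {s t : ℝ} (ht : 0 ≤ t) (f g : ℝ → E) :
    Set.EqOn (concatAt s f g) (fun r => g (r - s)) (Set.uIoc s (s + t)) := fun _ hr =>
  if_neg (Set.uIoc_of_le (le_add_of_nonneg_right ht) ▸ hr).1.not_ge

lemma intervalIntegrable_concatAt {E : Type*} [NormedAddCommGroup E] {s t : ℝ} (hs : 0 ≤ s)
    (ht : 0 ≤ t) {f g : ℝ → E} (hf : IntervalIntegrable f volume 0 s)
    (hg : IntervalIntegrable g volume 0 t) :
    IntervalIntegrable (concatAt s f g) volume 0 (s + t) := by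
  refine ((intervalIntegrable_congr (eqOn_concatAt_left hs f g)).2 hf).trans
    ((intervalIntegrable_congr (eqOn_concatAt_right ht f g)).2 ?_)
  simpa only [zero_add, add_comm t s] using hg.comp_sub_right s

variable {p : ℕ}

lemma IsPositiveInput.concatAt {s t : ℝ} (hs : 0 ≤ s) (ht : 0 ≤ t) {u v : ℝ → Fin p → ℝ}
    (hu : IsPositiveInput s u) (hv : IsPositiveInput t v) :
    IsPositiveInput (s + t) (concatAt s u v) := by
  refine ⟨fun σ => ?_, fun r hr σ => ?_⟩
  · convert intervalIntegrable_concatAt hs ht (hu.1 σ) (hv.1 σ) using 2 with r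
    exact apply_ite (fun w : Fin p → ℝ => w σ) _ _ _
  · rcases le_or_gt r s with hrs | hrs
    · exact (hu.2 r ⟨hr.1, hrs⟩ σ).trans_eq (congrFun (if_pos hrs).symm σ)
    · exact (hv.2 (r - s) ⟨sub_nonneg.2 hrs.le, sub_le_iff_le_add'.2 hr.2⟩ σ).trans_eq
        (congrFun (if_neg hrs.not_ge).symm σ)

variable {m : Type*} [Fintype m] {G : Matrix m (Fin p) ℝ} {u : ℝ → Fin p → ℝ}

lemma intervalIntegrable_input {s t : ℝ} (G : Matrix m (Fin p) ℝ)
    (hu : ∀ σ, IntervalIntegrable (fun t => u t σ) volume s t) :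
    IntervalIntegrable (fun t => G *ᵥ u t) volume s t :=
  intervalIntegrable_mulVec continuous_const
    (intervalIntegrable_iff.2 (Integrable.of_eval fun σ => intervalIntegrable_iff.1 (hu σ)))

variable [DecidableEq m] {A : Matrix m m ℝ}

lemma response_concatAt {s t : ℝ} (hs : 0 ≤ s) (ht : 0 ≤ t) {f g : ℝ → m → ℝ}
    (hf : IntervalIntegrable f volume 0 s) (hg : IntervalIntegrable g volume 0 t) :
    response A (concatAt s f g) (s + t) =
      NormedSpace.exp (t • A) *ᵥ response A f s + response A g t := by
  have hint := intervalIntegrable_mulVec (continuous_exp_sub_smul A (s + t))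
    (intervalIntegrable_concatAt hs ht hf hg)
  have hmem : s ∈ Set.uIcc 0 (s + t) := Set.mem_uIcc_of_le hs (le_add_of_nonneg_right ht)
  rw [response, ← intervalIntegral.integral_add_adjacent_intervals
    (hint.mono_set (Set.uIcc_subset_uIcc_left hmem))
    (hint.mono_set (Set.uIcc_subset_uIcc_right hmem))]
  congr 1
  · rw [response, mulVec_intervalIntegral _
      (intervalIntegrable_mulVec (continuous_exp_sub_smul A s) hf)]
    refine intervalIntegral.integral_congr_ae (Eventually.of_forall fun r hr => ?_)
    rw [eqOn_concatAt_left hs f g hr, mulVec_mulVec, ← exp_add_smul, add_sub_assoc', add_comm t]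
  · have hshift := intervalIntegral.integral_comp_sub_right (a := s) (b := s + t)
      (fun r => NormedSpace.exp ((t - r) • A) *ᵥ g r) s
    rw [sub_self, add_sub_cancel_left] at hshift
    rw [response, ← hshift]
    refine intervalIntegral.integral_congr_ae (Eventually.of_forall fun r hr => ?_)
    rw [eqOn_concatAt_right ht f g hr, sub_sub_eq_add_sub, add_comm t]

/-- The cone of states of `ẋ = A x + G u` that are positively reachable from the origin at time
`τ`. -/
def reachableAt (A : Matrix m m ℝ) (G : Matrix m (Fin p) ℝ) (τ : ℝ) : PointedCone ℝ (m → ℝ) where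
  carrier := {ξ | ∃ u, IsPositiveInput τ u ∧ ξ = response A (fun t => G *ᵥ u t) τ}
  add_mem' := by
    rintro _ _ ⟨u, hu, rfl⟩ ⟨v, hv, rfl⟩
    refine ⟨u + v, ⟨fun σ => (hu.1 σ).add (hv.1 σ), fun t ht σ =>
      add_nonneg (hu.2 t ht σ) (hv.2 t ht σ)⟩, ?_⟩
    simp only [response, Pi.add_apply, mulVec_add]
    exact (intervalIntegral.integral_add
      (intervalIntegrable_mulVec (continuous_exp_sub_smul A τ) (intervalIntegrable_input G hu.1))
      (intervalIntegrable_mulVec (continuous_exp_sub_smul A τ)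
        (intervalIntegrable_input G hv.1))).symm
  zero_mem' := ⟨0, ⟨fun _ => intervalIntegrable_const, fun _ _ _ => le_rfl⟩, by
    simp only [response, Pi.zero_apply, mulVec_zero, intervalIntegral.integral_zero]⟩
  smul_mem' := by
    rintro c _ ⟨u, hu, rfl⟩
    refine ⟨(c : ℝ) • u, ⟨fun σ => (hu.1 σ).const_mul c, fun t ht σ =>
      mul_nonneg c.2 (hu.2 t ht σ)⟩, ?_⟩
    simp only [response, Pi.smul_apply, mulVec_smul, intervalIntegral.integral_smul]
    rfl

lemma exp_mulVec_add_mem_reachableAt {s t : ℝ} (hs : 0 ≤ s) (ht : 0 ≤ t) {ξ ζ : m → ℝ}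
    (hξ : ξ ∈ reachableAt A G s) (hζ : ζ ∈ reachableAt A G t) :
    NormedSpace.exp (t • A) *ᵥ ξ + ζ ∈ reachableAt A G (s + t) := by
  obtain ⟨u, hu, rfl⟩ := hξ
  obtain ⟨v, hv, rfl⟩ := hζ
  refine ⟨concatAt s u v, hu.concatAt hs ht hv, ?_⟩
  rw [← response_concatAt hs ht (intervalIntegrable_input G hu.1) (intervalIntegrable_input G hv.1)]
  congr 1
  exact funext fun r => (apply_ite (G *ᵥ ·) _ _ _).symm

lemma reachableAt_mono {s t : ℝ} (hs : 0 ≤ s) (hst : s ≤ t) :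
    reachableAt A G s ≤ reachableAt A G t := fun ξ hξ => by
  simpa only [mulVec_zero, zero_add, sub_add_cancel] using
    exp_mulVec_add_mem_reachableAt (sub_nonneg.2 hst) hs (Submodule.zero_mem _) hξ

lemma exp_mulVec_mem_reachableAt {s t : ℝ} (hs : 0 ≤ s) (hst : s ≤ t) {ξ : m → ℝ}
    (hξ : ξ ∈ reachableAt A G s) : NormedSpace.exp ((t - s) • A) *ᵥ ξ ∈ reachableAt A G t := by
  simpa only [add_zero, add_sub_cancel] using
    exp_mulVec_add_mem_reachableAt hs (sub_nonneg.2 hst) hξ (Submodule.zero_mem _)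

/-- The cone of states of `ẋ = A x + G u` that are positively reachable from the origin in finite
time. -/
def reachableCone (A : Matrix m m ℝ) (G : Matrix m (Fin p) ℝ) : PointedCone ℝ (m → ℝ) where
  carrier := {ξ | ∃ τ, 0 ≤ τ ∧ ξ ∈ reachableAt A G τ}
  add_mem' := by
    rintro ξ ζ ⟨s, hs, hξ⟩ ⟨t, ht, hζ⟩
    exact ⟨max s t, le_max_of_le_left hs, Submodule.add_mem _
      (reachableAt_mono hs (le_max_left s t) hξ) (reachableAt_mono ht (le_max_right s t) hζ)⟩
  zero_mem' := ⟨0, le_rfl, Submodule.zero_mem _⟩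
  smul_mem' := fun c _ ⟨τ, hτ, hξ⟩ => ⟨τ, hτ, Submodule.smul_mem _ c hξ⟩

lemma response_dotProduct {τ : ℝ}
    (hu : ∀ σ, IntervalIntegrable (fun t => u t σ) volume 0 τ) (η : m → ℝ) :
    response A (fun t => G *ᵥ u t) τ ⬝ᵥ η = ∫ t in (0 : ℝ)..τ,
      u t ⬝ᵥ fun σ => (NormedSpace.exp ((τ - t) • A) *ᵥ G.col σ) ⬝ᵥ η := by
  have hcomm := ((dotProductBilin ℝ ℝ).flip η).toContinuousLinearMap.intervalIntegral_comp_comm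
    (intervalIntegrable_mulVec (continuous_exp_sub_smul A τ) (intervalIntegrable_input G hu))
  refine hcomm.symm.trans (intervalIntegral.integral_congr fun t _ => ?_)
  change (NormedSpace.exp ((τ - t) • A) *ᵥ (G *ᵥ u t)) ⬝ᵥ η = _
  rw [mulVec_mulVec, dotProduct_comm, dotProduct_mulVec, dotProduct_comm]
  exact congrArg _ (funext fun σ => dotProduct_comm _ _)

lemma nonneg_of_forall_integral_mul_nonneg {g : ℝ → ℝ} (hg : Continuous g) {τ : ℝ} (hτ : 0 < τ)
    (h : ∀ v : ℝ → ℝ, Continuous v → (∀ s, 0 ≤ v s) → 0 ≤ ∫ s in (0 : ℝ)..τ, v s * g s)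
    {s : ℝ} (hs : s ∈ Set.Icc 0 τ) : 0 ≤ g s := by
  have hcont : Continuous fun r => max 0 (-g r) := continuous_const.max hg.neg
  have hsq : ∀ r, max 0 (-g r) * g r = -(max 0 (-g r) * max 0 (-g r)) := fun r => by
    rcases le_total 0 (-g r) with h0 | h0
    · rw [max_eq_right h0, mul_neg, neg_mul, neg_neg]
    · rw [max_eq_left h0, zero_mul, zero_mul, neg_zero]
  have hint := h _ hcont fun r => le_max_left 0 (-g r)
  simp only [hsq, intervalIntegral.integral_neg, neg_nonneg] at hint
  by_contra! hneg
  refine hint.not_gt (intervalIntegral.integral_pos hτ (hcont.mul hcont).continuousOn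
    (fun r _ => mul_self_nonneg _) ⟨s, hs, mul_self_pos.2 (lt_max_of_lt_right ?_).ne'⟩)
  exact neg_pos.2 hneg

lemma forall_reachableCone_dotProduct_nonneg_iff {η : m → ℝ} :
    (∀ y ∈ reachableCone A G, 0 ≤ y ⬝ᵥ η) ↔
      ∀ σ, ∀ t : ℝ, 0 ≤ t → 0 ≤ (NormedSpace.exp (t • A) *ᵥ G.col σ) ⬝ᵥ η := by
  constructor
  · intro h σ t ht
    have hg : Continuous fun s : ℝ =>
        (NormedSpace.exp ((t + 1 - s) • A) *ᵥ G.col σ) ⬝ᵥ η :=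
      ((continuous_exp_sub_smul A (t + 1)).matrix_mulVec continuous_const).dotProduct
        continuous_const
    refine (nonneg_of_forall_integral_mul_nonneg hg (by linarith) (fun v hv hv₀ => ?_)
      ⟨zero_le_one, le_add_of_nonneg_left ht⟩).trans_eq (by rw [add_sub_cancel_right])
    have hu : IsPositiveInput (t + 1) fun s => Pi.single σ (v s) :=
      ⟨fun σ' => ((continuous_apply σ').comp
        ((continuous_single σ).comp hv)).intervalIntegrable _ _,
        fun s _ => (Pi.single_nonneg.2 (hv₀ s) : (0 : Fin p → ℝ) ≤ Pi.single σ (v s))⟩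
    have hy := h _ ⟨t + 1, by linarith, _, hu, rfl⟩
    simpa only [response_dotProduct hu.1, single_dotProduct] using hy
  · rintro h _ ⟨τ, hτ, u, hu, rfl⟩
    rw [response_dotProduct hu.1]
    exact intervalIntegral.integral_nonneg hτ fun t ht => dotProduct_nonneg_of_nonneg (hu.2 t ht)
      fun σ => h σ _ (sub_nonneg.2 ht.2)

end Reachability

section Array

variable {q p n : ℕ} {A : Matrix (Fin n) (Fin n) ℝ} {B : Fin q → Fin p → Fin n → ℝ}

lemma bigA_mulVec (A : Matrix (Fin n) (Fin n) ℝ) (ξ : Fin q × Fin n → ℝ) (i : Fin q) (a : Fin n) :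
    (bigA q A *ᵥ ξ) (i, a) = (A *ᵥ fun b => ξ (i, b)) a := by
  simp [bigA, mulVec, dotProduct, Fintype.sum_prod_type, one_apply]

lemma exp_smul_bigA (A : Matrix (Fin n) (Fin n) ℝ) (t : ℝ) :
    NormedSpace.exp (t • bigA q A) = bigA q (NormedSpace.exp (t • A)) := by
  rw [← exp_bigA]
  exact congrArg _ (kronecker_smul t 1 A).symm

lemma exp_smul_bigA_mulVec_col_dotProduct (η : Fin q × Fin n → ℝ) (σ : Fin p) (t : ℝ) :
    (NormedSpace.exp (t • bigA q A) *ᵥ (bigB B).col σ) ⬝ᵥ η =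
      output A B (fun i a => η (i, a)) σ t := by
  rw [exp_smul_bigA, dotProduct, Fintype.sum_prod_type]
  refine Finset.sum_congr rfl fun i _ => ?_
  rw [← transpose_smul, exp_transpose, dotProduct_mulVec, vecMul_transpose]
  exact Finset.sum_congr rfl fun a _ => by rw [bigA_mulVec]; rfl

lemma range_subset_closure_reachable_iff {k l : Fin q} :
    Set.range (pairMatrix ℝ k l n).mulVec ⊆ closure (reachable A B) ↔
      ∀ η : Fin q → Fin n → ℝ, (∀ σ t, 0 ≤ t → 0 ≤ output A B η σ t) → η k = η l := by
  have hcone : reachable A B = reachableCone (bigA q A) (bigB B) := rfl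
  simp only [hcone, range_pairMatrix_subset_closure_iff,
    forall_reachableCone_dotProduct_nonneg_iff, exp_smul_bigA_mulVec_col_dotProduct]
  exact ⟨fun h η hη => funext (h (fun ia => η ia.1 ia.2) hη),
    fun h η hη => congrFun (h (fun i a => η (i, a)) hη)⟩

end Array

/-! ### Trajectories of the array -/

section Trajectory

variable {q p n : ℕ} {A : Matrix (Fin n) (Fin n) ℝ} {B : Fin q → Fin p → Fin n → ℝ} {τ : ℝ}
  {u : ℝ → Fin p → ℝ} {k l : Fin q}

/-- The input term `∑_σ B_{iσ} u_σ` of the `i`th system of the array. -/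
def forcing (B : Fin q → Fin p → Fin n → ℝ) (u : ℝ → Fin p → ℝ) (i : Fin q) (t : ℝ) : Fin n → ℝ :=
  ∑ σ, u t σ • B i σ

lemma bigB_mulVec (B : Fin q → Fin p → Fin n → ℝ) (u : ℝ → Fin p → ℝ) (t : ℝ) (i : Fin q)
    (a : Fin n) : (bigB B *ᵥ u t) (i, a) = forcing B u i t a := by
  rw [forcing, Finset.sum_apply, mulVec, dotProduct]
  exact Finset.sum_congr rfl fun σ _ => mul_comm (B i σ a) (u t σ)

lemma intervalIntegrable_forcing (B : Fin q → Fin p → Fin n → ℝ)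
    (hu : ∀ σ, IntervalIntegrable (fun t => u t σ) volume 0 τ) (i : Fin q) :
    IntervalIntegrable (forcing B u i) volume 0 τ := by
  have h := intervalIntegrable_iff.1 (intervalIntegrable_input (bigB B) hu)
  refine intervalIntegrable_iff.2 (Integrable.of_eval fun a => ?_)
  simpa only [bigB_mulVec] using h.eval (i, a)

lemma sum_response_forcing (hB : IsRelative B)
    (hu : ∀ σ, IntervalIntegrable (fun t => u t σ) volume 0 τ) :
    ∑ i, response A (forcing B u i) τ = 0 := by
  have hsum : ∀ t, ∑ i, forcing B u i t = 0 := fun t => by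
    simp only [forcing]
    rw [Finset.sum_comm]
    simp only [← Finset.smul_sum, hB _, smul_zero, Finset.sum_const_zero]
  simp only [response]
  rw [← intervalIntegral.integral_finsetSum fun i _ => intervalIntegrable_mulVec
    (continuous_exp_sub_smul A τ) (intervalIntegrable_forcing B hu i)]
  simp only [← mulVec_sum, hsum, mulVec_zero, intervalIntegral.integral_zero]

lemma isTrajectory_exp_mulVec_add_response (hτ : 0 ≤ τ)
    (hu : ∀ σ, IntervalIntegrable (fun t => u t σ) volume 0 τ) (x₀ : Fin q → Fin n → ℝ) :
    IsTrajectory A B τ u fun t i =>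
      NormedSpace.exp (t • A) *ᵥ x₀ i + response A (forcing B u i) t := by
  have hb := intervalIntegrable_forcing B hu
  refine ⟨continuousOn_pi.2 fun i => (continuous_exp_smul_mulVec A (x₀ i)).continuousOn.add
    (continuousOn_response hτ (hb i)), fun t ht i => ?_⟩
  simp only [zero_smul, NormedSpace.exp_zero, one_mulVec, response_zero_right, add_zero]
  exact exp_mulVec_add_response_eq_integral ht.1 (intervalIntegrable_of_mem_Icc (hb i) ht) (x₀ i)

lemma IsTrajectory.eq_exp_mulVec_add_response {x : ℝ → Fin q → Fin n → ℝ}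
    (hx : IsTrajectory A B τ u x) (hτ : 0 ≤ τ)
    (hu : ∀ σ, IntervalIntegrable (fun t => u t σ) volume 0 τ) (i : Fin q) :
    x τ i = NormedSpace.exp (τ • A) *ᵥ x 0 i + response A (forcing B u i) τ :=
  RelArray.eq_exp_mulVec_add_response hτ (intervalIntegrable_forcing B hu i)
    (continuousOn_pi.1 hx.1 i) fun t ht => hx.2 t ht i

lemma positivelyPairControllable_iff_response :
    PositivelyPairControllable A B k l ↔ ∀ x₀ : Fin q → Fin n → ℝ, ∃ τ : ℝ, 0 < τ ∧ ∃ u,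
      IsPositiveInput τ u ∧
      NormedSpace.exp (τ • A) *ᵥ x₀ k + response A (forcing B u k) τ =
        NormedSpace.exp (τ • A) *ᵥ x₀ l + response A (forcing B u l) τ ∧
      ∀ i, i ≠ k → i ≠ l → response A (forcing B u i) τ = 0 := by
  refine forall_congr' fun x₀ => exists_congr fun τ => and_congr_right fun hτ =>
    exists_congr fun u => and_congr_right fun hu => ?_
  constructor
  · rintro ⟨x, hx, rfl, hkl, hi⟩
    have hxτ := hx.eq_exp_mulVec_add_response hτ.le hu.1
    rw [hxτ k, hxτ l] at hkl
    exact ⟨hkl, fun i hik hil => left_eq_add.1 ((hi i hik hil).symm.trans (hxτ i))⟩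
  · rintro ⟨hkl, hi⟩
    refine ⟨_, isTrajectory_exp_mulVec_add_response hτ.le hu.1 x₀, funext fun i => ?_, hkl,
      fun i hik hil => add_eq_left.2 (hi i hik hil)⟩
    rw [zero_smul, NormedSpace.exp_zero, one_mulVec, response_zero_right, add_zero]

lemma add_eq_add_and_forall_eq_zero_iff {E : Type*} [AddCommGroup E] [Module ℝ E] {r : Fin q → E}
    (hr : ∑ i, r i = 0) (hkl : k ≠ l) {y z : E} :
    (y + r k = z + r l ∧ ∀ i, i ≠ k → i ≠ l → r i = 0) ↔
      ∀ i, r i = (Pi.single k 1 - Pi.single l 1 : Fin q → ℝ) i • ((2 : ℝ)⁻¹ • (z - y)) := by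
  constructor
  · rintro ⟨h, h₀⟩ i
    have hkr : r k + r l = 0 := by
      rw [← hr, Fintype.sum_eq_add k l hkl fun i hi => h₀ i hi.1 hi.2]
    have hl : r l = -r k := eq_neg_of_add_eq_zero_right hkr
    have hk : z - y = (2 : ℝ) • r k := by
      rw [two_smul, sub_eq_iff_eq_add, add_assoc, ← add_comm y, h, hl]
      abel
    rw [hk, inv_smul_smul₀ two_ne_zero]
    rcases eq_or_ne i k with rfl | hik
    · simp [hkl]
    rcases eq_or_ne i l with rfl | hil
    · simp [hik, hl]
    · simp [hik, hil, h₀]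
  · intro h
    refine ⟨?_, fun i hik hil => by simp [h i, hik, hil]⟩
    rw [h k, h l]
    simp only [Pi.sub_apply, Pi.single_eq_same, Pi.single_eq_of_ne hkl, Pi.single_eq_of_ne hkl.symm]
    module

lemma response_bigA {b : ℝ → Fin q × Fin n → ℝ} (hb : IntervalIntegrable b volume 0 τ)
    (i : Fin q) :
    (fun a => response (bigA q A) b τ (i, a)) = response A (fun t a => b t (i, a)) τ := by
  have hblock := (LinearMap.funLeft ℝ ℝ fun a : Fin n =>
    (i, a)).toContinuousLinearMap.intervalIntegral_comp_comm
      (intervalIntegrable_mulVec (continuous_exp_sub_smul (bigA q A) τ) hb)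
  refine hblock.symm.trans (intervalIntegral.integral_congr fun t _ => funext fun a => ?_)
  rw [exp_smul_bigA]
  exact bigA_mulVec _ _ i a

lemma mem_reachableAt_bigA_iff {ξ : Fin q × Fin n → ℝ} :
    ξ ∈ reachableAt (bigA q A) (bigB B) τ ↔ ∃ u, IsPositiveInput τ u ∧
      ∀ i, response A (forcing B u i) τ = fun a => ξ (i, a) := by
  refine exists_congr fun u => and_congr_right fun hu => ?_
  have hblock : ∀ i, (fun a => response (bigA q A) (fun t => bigB B *ᵥ u t) τ (i, a)) =
      response A (forcing B u i) τ := fun i => by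
    rw [response_bigA (intervalIntegrable_input (bigB B) hu.1)]
    simp only [bigB_mulVec]
  constructor
  · rintro rfl i
    exact (hblock i).symm
  · exact fun h => funext fun ia => congrFun ((h ia.1).symm.trans (hblock ia.1).symm) ia.2

lemma positivelyPairControllable_iff_exp (hB : IsRelative B) (hkl : k ≠ l) :
    PositivelyPairControllable A B k l ↔ ∀ w : Fin n → ℝ, ∃ τ : ℝ, 0 < τ ∧
      pairMatrix ℝ k l n *ᵥ (NormedSpace.exp (τ • A) *ᵥ w) ∈
        reachableAt (bigA q A) (bigB B) τ := by
  have hstep : PositivelyPairControllable A B k l ↔ ∀ x₀ : Fin q → Fin n → ℝ, ∃ τ : ℝ, 0 < τ ∧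
      pairMatrix ℝ k l n *ᵥ (NormedSpace.exp (τ • A) *ᵥ ((2 : ℝ)⁻¹ • (x₀ l - x₀ k))) ∈
        reachableAt (bigA q A) (bigB B) τ := by
    simp only [positivelyPairControllable_iff_response, mem_reachableAt_bigA_iff,
      pairMatrix_mulVec]
    refine forall_congr' fun x₀ => exists_congr fun τ => and_congr_right fun _ =>
      exists_congr fun u => and_congr_right fun hu => ?_
    rw [mulVec_smul, mulVec_sub]
    exact add_eq_add_and_forall_eq_zero_iff (sum_response_forcing hB hu.1) hkl
  rw [hstep]
  refine ⟨fun h w => ?_, fun h x₀ => h _⟩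
  simpa only [Pi.single_eq_same, Pi.single_eq_of_ne hkl, sub_zero,
    inv_smul_smul₀ (two_ne_zero (α := ℝ))] using h (Pi.single l ((2 : ℝ) • w))

lemma exp_smul_bigA_mulVec_pairMatrix_mulVec (A : Matrix (Fin n) (Fin n) ℝ) (k l : Fin q) (t : ℝ)
    (w : Fin n → ℝ) :
    NormedSpace.exp (t • bigA q A) *ᵥ (pairMatrix ℝ k l n *ᵥ w) =
      pairMatrix ℝ k l n *ᵥ (NormedSpace.exp (t • A) *ᵥ w) := by
  ext ⟨i, a⟩
  simp only [exp_smul_bigA, bigA_mulVec, pairMatrix_mulVec]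
  exact congrFun (mulVec_smul (NormedSpace.exp (t • A))
    ((Pi.single k 1 - Pi.single l 1 : Fin q → ℝ) i) w) a

lemma positivelyPairControllable_iff (hB : IsRelative B) (hkl : k ≠ l) :
    PositivelyPairControllable A B k l ↔
      Set.range (pairMatrix ℝ k l n).mulVec ⊆ reachable A B := by
  rw [positivelyPairControllable_iff_exp hB hkl, Set.range_subset_iff]
  constructor
  · intro h w
    let E : ℝ → (Fin q × Fin n → ℝ) →ₗ[ℝ] (Fin q × Fin n → ℝ) := fun τ =>
      (NormedSpace.exp (τ • bigA q A)).mulVecLin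
    have hmono : ∀ s t, 0 ≤ s → s ≤ t →
        (reachableAt (bigA q A) (bigB B) s).comap (E s) ≤
          (reachableAt (bigA q A) (bigB B) t).comap (E t) := fun s t hs hst ξ hξ => by
      have hst' : NormedSpace.exp ((t - s) • bigA q A) *ᵥ (NormedSpace.exp (s • bigA q A) *ᵥ ξ) ∈
        reachableAt (bigA q A) (bigB B) t := exp_mulVec_mem_reachableAt hs hst hξ
      rw [mulVec_mulVec, ← exp_add_smul, sub_add_cancel] at hst'
      exact hst'
    obtain ⟨τ, hτ, hw⟩ := exists_forall_mem_of_monotoneOn_cones hmono (pairMatrix ℝ k l n).mulVecLin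
      fun v => by
        obtain ⟨τ, hτ, hv⟩ := h v
        rw [← exp_smul_bigA_mulVec_pairMatrix_mulVec] at hv
        exact ⟨τ, hτ.le, hv⟩
    have hcancel : NormedSpace.exp (τ • A) *ᵥ (NormedSpace.exp (-τ • A) *ᵥ w) = w := by
      rw [mulVec_mulVec, ← exp_add_smul, add_neg_cancel, zero_smul, NormedSpace.exp_zero,
        one_mulVec]
    have hw' : NormedSpace.exp (τ • bigA q A) *ᵥ (pairMatrix ℝ k l n *ᵥ
        (NormedSpace.exp (-τ • A) *ᵥ w)) ∈ reachableAt (bigA q A) (bigB B) τ := hw _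
    rw [exp_smul_bigA_mulVec_pairMatrix_mulVec, hcancel] at hw'
    exact ⟨τ, hτ.le, hw'⟩
  · intro h
    obtain ⟨τ, hτ, hw⟩ := exists_forall_mem_of_monotoneOn_cones
      (C := reachableAt (bigA q A) (bigB B)) (fun _ _ => reachableAt_mono)
      (pairMatrix ℝ k l n).mulVecLin h
    exact fun w => ⟨τ, hτ, hw _⟩

end Trajectory

end RelArray

end

theorem theorem5 {q p n : ℕ} (A : Matrix (Fin n) (Fin n) ℝ) (B : Fin q → Fin p → Fin n → ℝ)
    (hB : RelArray.IsRelative B) (k l : Fin q) (hkl : k ≠ l) (D : RelArray.SpectralData A)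
    (h₁ : D.SemisimpleAssumption) (h₂ : RelArray.ClosureAssumption A B k l) :
    RelArray.PositivelyPairControllable A B k l ↔
      ((∀ κ, (D.μ κ).im = 0 → RelArray.StronglyPairConnected (D.incQ B κ) k l) ∧
        (∀ κ, (D.μ κ).im ≠ 0 → RelArray.PairConnected (D.incQ B κ) k l)) := by
  rw [RelArray.positivelyPairControllable_iff hB hkl]
  constructor
  · intro h
    have hP := RelArray.range_subset_closure_reachable_iff.1 (h.trans subset_closure)
    exact ⟨fun κ hκ => RelArray.SpectralData.stronglyPairConnected_of_output h₁ hP hκ,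
      fun κ _ => RelArray.SpectralData.pairConnected_of_output h₁ hP κ⟩
  · rintro ⟨ha, hb⟩
    exact h₂ (RelArray.range_subset_closure_reachable_iff.2 fun η hη =>
      RelArray.SpectralData.eq_of_output_nonneg ha hb hη)
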